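/- Let $n\ge 1$, $\theta\in(0,1)$, $1\le q_0<p_0<\infty$, $1\le q_1<p_1<\infty$, $\frac{p_0}{q_0}=\frac{p_1}{q_1}$, $q_0\ne q_1$, and define $p$ by $\frac1p=\frac{1-\theta}{p_0}+\frac{\theta}{p_1}$. For $1\le s\le t<\infty$, $r>0$ and measurable $f:\mathbb R^n\to\mathbb C$ (modulo equality a.e.) put $$m(f,t,s;r)=\sup_{x\in\mathbb R^n}|B(x,r)|^{\frac1t}\Big(\frac1{|B(x,r)|}\int_{B(x,r)}|f(y)|^s\,dy\Big)^{\frac1s},\qquad \|f\|_{\mathcal M^t_s}=\sup_{r>0}m(f,t,s;r).$$ Let $\mathcal M^t_s$ be the space of all $f$ with $\|f\|_{\mathcal M^t_s}<\infty$, and consider its subspaces, with the same norm, $V_0\mathcal M^t_s=\{f\in\mathcal M^t_s:\lim_{r\to0^+}m(f,t,s;r)=0\}$, $V_\infty\mathcal M^t_s=\{f\in\mathcal M^t_s:\lim_{r\to\infty}m(f,t,s;r)=0\}$ and $V^{(*)}\mathcal M^t_s=\{f\in\mathcal M^t_s:\lim_{N\to\infty}\sup_{x}\int_{B(x,1)}|f|^s\chi_{\mathbb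 R^n\setminus B(0,N)}\,dy=0\}$. For a compatible couple $(X_0,X_1)$ of Banach spaces and $S=\{0<\operatorname{Re}z<1\}$, the first complex interpolation space is $[X_0,X_1]_\theta=\{F(\theta)\}$, where $F$ runs over the bounded continuous functions $\overline S\to X_0+X_1$ that are holomorphic in $S$ and for which $t\mapsto F(k+it)$ is a bounded continuous function $\mathbb R\to X_k$ ($k=0,1$). The second complex interpolation space is $[X_0,X_1]^\theta=\{G'(\theta)\}$, where $G$ runs over the continuous functions $\overline S\to X_0+X_1$ that are holomorphic in $S$, satisfy $\sup_{z\in\overline S}\|G(z)\|_{X_0+X_1}/(1+|z|)<\infty$, and for which $t\mapsto G(k+it)$ is a Lipschitz function $\mathbb R\to X_k$ ($k=0,1$). Then the function $f_3(x)=|x|^{-n/p}$ on $\mathbb R^n$ satisfies $$f_3\in[V_0\mathcal M^{p_0}_{q_0},V_0\mathcal M^{p_1}_{q_1}]^\theta\setminus[V_0\mathcal M^{p_0}_{q_0},V_0\mathcal M^{p_1}_{q_1}]_\theta,$$ $$f_3\in[V^{(*)}\mathcal M^{p_0}_{q_0},V^{(*)}\mathcal M^{p_1}_{q_1}]^\theta\cap[V_\infty\mathcal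 M^{p_0}_{q_0},V_\infty\mathcal M^{p_1}_{q_1}]^\theta,$$ $$f_3\notin[V^{(*)}\mathcal M^{p_0}_{q_0},V^{(*)}\mathcal M^{p_1}_{q_1}]_\theta\cup[V_\infty\mathcal M^{p_0}_{q_0},V_\infty\mathcal M^{p_1}_{q_1}]_\theta.$$ -/

import Mathlib

open MeasureTheory Filter Topology Metric Set
open scoped ENNReal

noncomputable section

namespace ComplexInterpolation

variable {X₀ X₁ Z : Type*} [NormedAddCommGroup X₀] [NormedSpace ℂ X₀]
  [NormedAddCommGroup X₁] [NormedSpace ℂ X₁] [AddCommGroup Z] [Module ℂ Z]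

/-- The pairs `(x₀, x₁)`, normed by `‖x₀‖ + ‖x₁‖`, whose sum vanishes in the ambient space. -/
def sumKer (ι₀ : X₀ →ₗ[ℂ] Z) (ι₁ : X₁ →ₗ[ℂ] Z) : Submodule ℂ (WithLp 1 (X₀ × X₁)) :=
  LinearMap.ker ((ι₀.coprod ι₁) ∘ₗ (WithLp.linearEquiv 1 ℂ (X₀ × X₁)).toLinearMap)

/-- The sum space `X₀ + X₁` of two spaces embedded in `Z` by `ι₀` and `ι₁`. Its quotient norm is
`‖x‖ = inf {‖x₀‖ + ‖x₁‖ : x = x₀ + x₁}`. -/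
abbrev SumSpace (ι₀ : X₀ →ₗ[ℂ] Z) (ι₁ : X₁ →ₗ[ℂ] Z) : Type _ :=
  WithLp 1 (X₀ × X₁) ⧸ sumKer ι₀ ι₁

/-- The injection of `X₀ + X₁` into the ambient space. -/
def SumSpace.toAmbient (ι₀ : X₀ →ₗ[ℂ] Z) (ι₁ : X₁ →ₗ[ℂ] Z) : SumSpace ι₀ ι₁ →ₗ[ℂ] Z :=
  (sumKer ι₀ ι₁).liftQ ((ι₀.coprod ι₁) ∘ₗ (WithLp.linearEquiv 1 ℂ (X₀ × X₁)).toLinearMap) le_rfl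

/-- The inclusion of `X₀` in `X₀ + X₁`. -/
def SumSpace.left (ι₀ : X₀ →ₗ[ℂ] Z) (ι₁ : X₁ →ₗ[ℂ] Z) (x : X₀) : SumSpace ι₀ ι₁ :=
  (sumKer ι₀ ι₁).mkQ (WithLp.toLp 1 (x, 0))

/-- The inclusion of `X₁` in `X₀ + X₁`. -/
def SumSpace.right (ι₀ : X₀ →ₗ[ℂ] Z) (ι₁ : X₁ →ₗ[ℂ] Z) (x : X₁) : SumSpace ι₀ ι₁ :=
  (sumKer ι₀ ι₁).mkQ (WithLp.toLp 1 (0, x))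

/-- The open strip `0 < Re z < 1`. -/
def strip : Set ℂ := {z | 0 < z.re ∧ z.re < 1}

/-- The closed strip `0 ≤ Re z ≤ 1`. -/
def closedStrip : Set ℂ := {z | 0 ≤ z.re ∧ z.re ≤ 1}

/-- The first complex interpolation functor `𝓕(X₀, X₁)`. Only the values of `F` on the closed
strip matter. -/
structure MemF (ι₀ : X₀ →ₗ[ℂ] Z) (ι₁ : X₁ →ₗ[ℂ] Z) (F : ℂ → SumSpace ι₀ ι₁) : Prop where
  continuousOn : ContinuousOn F closedStrip
  bounded : ∃ C : ℝ, ∀ z ∈ closedStrip, ‖F z‖ ≤ C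
  holomorphic : DifferentiableOn ℂ F strip
  boundary₀ : ∃ f : ℝ → X₀, Continuous f ∧ (∃ C : ℝ, ∀ t, ‖f t‖ ≤ C) ∧
    ∀ t : ℝ, F (t * Complex.I) = SumSpace.left ι₀ ι₁ (f t)
  boundary₁ : ∃ f : ℝ → X₁, Continuous f ∧ (∃ C : ℝ, ∀ t, ‖f t‖ ≤ C) ∧
    ∀ t : ℝ, F (1 + t * Complex.I) = SumSpace.right ι₀ ι₁ (f t)

/-- The second complex interpolation functor `𝓖(X₀, X₁)`. Only the values of `G` on the closed
strip matter. -/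
structure MemG (ι₀ : X₀ →ₗ[ℂ] Z) (ι₁ : X₁ →ₗ[ℂ] Z) (G : ℂ → SumSpace ι₀ ι₁) : Prop where
  continuousOn : ContinuousOn G closedStrip
  growth : ∃ C : ℝ, ∀ z ∈ closedStrip, ‖G z‖ ≤ C * (1 + ‖z‖)
  holomorphic : DifferentiableOn ℂ G strip
  boundary₀ : ∃ g : ℝ → X₀, (∃ K, LipschitzWith K g) ∧
    ∀ t : ℝ, G (t * Complex.I) = SumSpace.left ι₀ ι₁ (g t)
  boundary₁ : ∃ g : ℝ → X₁, (∃ K, LipschitzWith K g) ∧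
    ∀ t : ℝ, G (1 + t * Complex.I) = SumSpace.right ι₀ ι₁ (g t)

/-- The first complex interpolation space `[X₀, X₁]_θ`, as a subset of the ambient space. -/
def firstSpace (ι₀ : X₀ →ₗ[ℂ] Z) (ι₁ : X₁ →ₗ[ℂ] Z) (θ : ℝ) : Set Z :=
  {x | ∃ F, MemF ι₀ ι₁ F ∧ SumSpace.toAmbient ι₀ ι₁ (F θ) = x}

/-- The second complex interpolation space `[X₀, X₁]^θ`, as a subset of the ambient space. -/
def secondSpace (ι₀ : X₀ →ₗ[ℂ] Z) (ι₁ : X₁ →ₗ[ℂ] Z) (θ : ℝ) : Set Z :=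
  {x | ∃ G, MemG ι₀ ι₁ G ∧ ∃ d, HasDerivAt G d (θ : ℂ) ∧ SumSpace.toAmbient ι₀ ι₁ d = x}

end ComplexInterpolation

namespace Morrey

/-- Classes of measurable functions `ℝⁿ → ℂ` modulo equality almost everywhere. -/
abbrev L0 (n : ℕ) : Type := EuclideanSpace ℝ (Fin n) →ₘ[volume] ℂ

variable {n : ℕ}

/-- `m(f,p,q;r) = sup_x |B(x,r)|^{1/p} (|B(x,r)|⁻¹ ∫_{B(x,r)} |f|^q)^{1/q}`. -/
def m (f : L0 n) (p q r : ℝ) : ℝ≥0∞ :=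
  ⨆ x : EuclideanSpace ℝ (Fin n), volume (ball x r) ^ (1 / p) *
    ((volume (ball x r))⁻¹ * ∫⁻ y in ball x r, ‖f y‖ₑ ^ q) ^ (1 / q)

/-- The Morrey norm, with value `∞` allowed. -/
def eNorm (f : L0 n) (p q : ℝ) : ℝ≥0∞ := ⨆ r : ℝ, ⨆ _ : 0 < r, m f p q r

/-- `sup_x ∫_{B(x,1)} |f|^q χ_{ℝⁿ ∖ B(0,N)}`. -/
def tail (f : L0 n) (q : ℝ) (N : ℕ) : ℝ≥0∞ :=
  ⨆ x : EuclideanSpace ℝ (Fin n), ∫⁻ y in ball x 1,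
    (ball (0 : EuclideanSpace ℝ (Fin n)) N)ᶜ.indicator (fun y => ‖f y‖ₑ ^ q) y

variable {p q : ℝ}

theorem m_zero (hq : 1 ≤ q) (r : ℝ) : m (0 : L0 n) p q r = 0 := by
  have hq0 : 0 < q := by linarith
  simp [m, hq0]

theorem m_add_le (hq : 1 ≤ q) (f g : L0 n) (r : ℝ) :
    m (f + g) p q r ≤ m f p q r + m g p q r := by
  have hq0 : 0 < q := by linarith
  have hq1 : 0 ≤ 1 / q := by positivity
  refine iSup_le fun x => ?_
  have key : (∫⁻ y in ball x r, ‖(f + g) y‖ₑ ^ q) ^ (1 / q) ≤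
      (∫⁻ y in ball x r, ‖f y‖ₑ ^ q) ^ (1 / q) + (∫⁻ y in ball x r, ‖g y‖ₑ ^ q) ^ (1 / q) := by
    refine le_trans ?_ (ENNReal.lintegral_Lp_add_le (μ := volume.restrict (ball x r))
      (f := fun y => ‖f y‖ₑ) (g := fun y => ‖g y‖ₑ)
      f.aestronglyMeasurable.restrict.enorm g.aestronglyMeasurable.restrict.enorm hq)
    refine ENNReal.rpow_le_rpow (lintegral_mono_ae ?_) hq1
    filter_upwards [ae_restrict_of_ae (AEEqFun.coeFn_add f g)] with y hy
    rw [hy]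
    exact ENNReal.rpow_le_rpow (_root_.enorm_add_le _ _) hq0.le
  refine le_trans ?_ (add_le_add (le_iSup _ x) (le_iSup _ x))
  simp only [ENNReal.mul_rpow_of_nonneg _ _ hq1]
  rw [← mul_add, ← mul_add]
  gcongr

theorem m_smul (hq : 1 ≤ q) (c : ℂ) (f : L0 n) (r : ℝ) :
    m (c • f) p q r = ‖c‖ₑ * m f p q r := by
  have hq0 : 0 < q := by linarith
  have hq1 : 0 ≤ 1 / q := by positivity
  unfold m
  rw [ENNReal.mul_iSup]
  congr 1
  ext x
  have h : ∫⁻ y in ball x r, ‖(c • f) y‖ₑ ^ q = ‖c‖ₑ ^ q * ∫⁻ y in ball x r, ‖f y‖ₑ ^ q := by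
    rw [← lintegral_const_mul' _ _ (by finiteness)]
    refine lintegral_congr_ae ?_
    filter_upwards [ae_restrict_of_ae (AEEqFun.coeFn_smul c f)] with y hy
    rw [hy, Pi.smul_apply, _root_.enorm_smul, ENNReal.mul_rpow_of_nonneg _ _ hq0.le]
  rw [h]
  simp only [ENNReal.mul_rpow_of_nonneg _ _ hq1]
  rw [← ENNReal.rpow_mul, mul_one_div_cancel hq0.ne', ENNReal.rpow_one]
  ring

theorem eNorm_zero (hq : 1 ≤ q) : eNorm (0 : L0 n) p q = 0 := by simp [eNorm, m_zero hq]

theorem eNorm_add_le (hq : 1 ≤ q) (f g : L0 n) :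
    eNorm (f + g) p q ≤ eNorm f p q + eNorm g p q :=
  iSup₂_le fun r hr => (m_add_le hq f g r).trans
    (add_le_add (le_iSup₂_of_le r hr le_rfl) (le_iSup₂_of_le r hr le_rfl))

theorem eNorm_smul (hq : 1 ≤ q) (c : ℂ) (f : L0 n) :
    eNorm (c • f) p q = ‖c‖ₑ * eNorm f p q := by
  simp only [eNorm, m_smul hq, ENNReal.mul_iSup]

theorem eq_zero_of_eNorm (hq : 1 ≤ q) (f : L0 n) (h : eNorm f p q = 0) : f = 0 := by
  have hq0 : 0 < q := by linarith
  have hb : ∀ k : ℕ, ∀ᵐ y ∂(volume.restrict (ball (0 : EuclideanSpace ℝ (Fin n)) (k + 1))),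
      f y = 0 := by
    intro k
    have hk : (0 : ℝ) < k + 1 := by positivity
    have h1 : volume (ball (0 : EuclideanSpace ℝ (Fin n)) (k + 1)) ^ (1 / p) *
        ((volume (ball (0 : EuclideanSpace ℝ (Fin n)) (k + 1)))⁻¹ *
          ∫⁻ y in ball 0 ((k : ℝ) + 1), ‖f y‖ₑ ^ q) ^ (1 / q) ≤ 0 := by
      rw [← h]
      exact le_trans (le_iSup (fun x : EuclideanSpace ℝ (Fin n) =>
        volume (ball x ((k : ℝ) + 1)) ^ (1 / p) * ((volume (ball x ((k : ℝ) + 1)))⁻¹ *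
          ∫⁻ y in ball x ((k : ℝ) + 1), ‖f y‖ₑ ^ q) ^ (1 / q)) 0)
        (le_iSup₂_of_le ((k : ℝ) + 1) hk le_rfl)
    have hpos := measure_ball_pos volume (0 : EuclideanSpace ℝ (Fin n)) hk
    have hfin := (measure_ball_lt_top (μ := volume) (x := (0 : EuclideanSpace ℝ (Fin n)))
      (r := (k : ℝ) + 1))
    have h2 := mul_eq_zero.1 (le_zero_iff.1 h1)
    have h3 := h2.resolve_left (ENNReal.rpow_pos hpos hfin.ne).ne'
    have h4 := (ENNReal.rpow_eq_zero_iff_of_pos (by positivity)).1 h3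
    have h5 := (mul_eq_zero.1 h4).resolve_left (ENNReal.inv_ne_zero.2 hfin.ne)
    rw [lintegral_eq_zero_iff' (by
      exact f.aestronglyMeasurable.restrict.enorm.pow_const q)] at h5
    filter_upwards [h5] with y hy
    simpa [ENNReal.rpow_eq_zero_iff_of_pos hq0] using hy
  refine AEEqFun.ext (EventuallyEq.trans ?_ AEEqFun.coeFn_zero.symm)
  have := (ae_restrict_iUnion_iff (μ := volume)
    (fun k : ℕ => ball (0 : EuclideanSpace ℝ (Fin n)) (k + 1)) (fun y => f y = 0)).2 hb
  rw [iUnion_ball_nat_succ, Measure.restrict_univ] at this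
  exact this

theorem tail_zero (hq : 1 ≤ q) (N : ℕ) : tail (0 : L0 n) q N = 0 := by
  have hq0 : 0 < q := by linarith
  simp only [tail, ENNReal.iSup_eq_zero]
  intro x
  rw [lintegral_congr_ae (g := fun _ => 0), lintegral_zero]
  filter_upwards [ae_restrict_of_ae (AEEqFun.coeFn_zero (β := ℂ)
      (μ := (volume : Measure (EuclideanSpace ℝ (Fin n)))))] with y hy
  simp only [indicator]
  split_ifs
  · rw [hy]
    simp [hq0]
  · rfl

theorem tail_add_le (hq : 1 ≤ q) (f g : L0 n) (N : ℕ) :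
    tail (f + g) q N ≤ 2 ^ (q - 1) * (tail f q N + tail g q N) := by
  have hq0 : 0 < q := by linarith
  refine iSup_le fun x => ?_
  refine le_trans ?_ (mul_le_mul_right (add_le_add (le_iSup _ x) (le_iSup _ x)) _)
  have hfm : AEMeasurable ((ball (0 : EuclideanSpace ℝ (Fin n)) N)ᶜ.indicator
      (fun y => ‖f y‖ₑ ^ q)) (volume.restrict (ball x 1)) := by
    refine AEMeasurable.indicator ?_ measurableSet_ball.compl
    exact f.aestronglyMeasurable.restrict.enorm.pow_const q
  rw [← lintegral_add_left' hfm, ← lintegral_const_mul' _ _ (by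
    exact (ENNReal.rpow_lt_top_of_nonneg (by linarith) (by simp)).ne)]
  refine lintegral_mono_ae ?_
  filter_upwards [ae_restrict_of_ae (AEEqFun.coeFn_add f g)] with y hy
  simp only [indicator]
  split_ifs
  · rw [hy]
    exact (ENNReal.rpow_le_rpow (_root_.enorm_add_le _ _) hq0.le).trans
      (ENNReal.rpow_add_le_mul_rpow_add_rpow _ _ hq)
  · simp

theorem tail_smul (hq : 1 ≤ q) (c : ℂ) (f : L0 n) (N : ℕ) :
    tail (c • f) q N = ‖c‖ₑ ^ q * tail f q N := by
  have hq0 : 0 < q := by linarith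
  unfold tail
  rw [ENNReal.mul_iSup]
  congr 1
  ext x
  rw [← lintegral_const_mul' _ _ (by finiteness)]
  refine lintegral_congr_ae ?_
  filter_upwards [ae_restrict_of_ae (AEEqFun.coeFn_smul c f)] with y hy
  simp only [indicator]
  split_ifs
  · rw [hy, Pi.smul_apply, _root_.enorm_smul, ENNReal.mul_rpow_of_nonneg _ _ hq0.le]
  · simp

/-- The Morrey space `𝓜^p_q(ℝⁿ)` of complex valued functions (finite norm already forces
`f ∈ L^q_loc`). -/
def space (n : ℕ) (p q : ℝ) [hq : Fact (1 ≤ q)] : Submodule ℂ (L0 n) where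
  carrier := {f | eNorm f p q < ∞}
  zero_mem' := by simp [eNorm_zero hq.out]
  add_mem' {f g} hf hg := (eNorm_add_le hq.out f g).trans_lt (ENNReal.add_lt_top.2 ⟨hf, hg⟩)
  smul_mem' c f hf := by
    change eNorm (c • f) p q < ∞
    rw [eNorm_smul hq.out]
    exact ENNReal.mul_lt_top enorm_lt_top hf

instance (n : ℕ) (p q : ℝ) [hq : Fact (1 ≤ q)] : Norm (space n p q) :=
  ⟨fun f => (eNorm (f : L0 n) p q).toReal⟩

theorem norm_def (n : ℕ) (p q : ℝ) [Fact (1 ≤ q)] (f : space n p q) :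
    ‖f‖ = (eNorm (f : L0 n) p q).toReal := rfl

theorem normedCore (n : ℕ) (p q : ℝ) [hq : Fact (1 ≤ q)] :
    NormedSpace.Core ℂ (space n p q) where
  norm_nonneg _ := ENNReal.toReal_nonneg
  norm_smul c f := by
    rw [norm_def, norm_def, Submodule.coe_smul, eNorm_smul hq.out, ENNReal.toReal_mul,
      toReal_enorm]
  norm_triangle f g := by
    have hf : eNorm (f : L0 n) p q < ∞ := f.2
    have hg : eNorm (g : L0 n) p q < ∞ := g.2
    rw [norm_def, norm_def, norm_def, Submodule.coe_add, ← ENNReal.toReal_add hf.ne hg.ne]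
    exact ENNReal.toReal_mono (ENNReal.add_lt_top.2 ⟨hf, hg⟩).ne (eNorm_add_le hq.out _ _)
  norm_eq_zero_iff f := by
    have hf : eNorm (f : L0 n) p q < ∞ := f.2
    rw [norm_def, ENNReal.toReal_eq_zero_iff, or_iff_left hf.ne]
    constructor
    · intro h
      exact Subtype.ext (eq_zero_of_eNorm hq.out _ h)
    · rintro rfl
      exact eNorm_zero hq.out

instance (n : ℕ) (p q : ℝ) [Fact (1 ≤ q)] : NormedAddCommGroup (space n p q) :=
  NormedAddCommGroup.ofCore (normedCore n p q)

instance (n : ℕ) (p q : ℝ) [Fact (1 ≤ q)] : NormedSpace ℂ (space n p q) :=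
  NormedSpace.ofCore (normedCore n p q)

theorem tendsto_m_add (hq : 1 ≤ q) {l : Filter ℝ} {f g : L0 n}
    (hf : Tendsto (fun r => m f p q r) l (𝓝 0)) (hg : Tendsto (fun r => m g p q r) l (𝓝 0)) :
    Tendsto (fun r => m (f + g) p q r) l (𝓝 0) :=
  tendsto_of_tendsto_of_tendsto_of_le_of_le tendsto_const_nhds
    (by simpa using hf.add hg) (fun _ => zero_le) (fun r => m_add_le hq f g r)

theorem tendsto_m_smul (hq : 1 ≤ q) {l : Filter ℝ} (c : ℂ) {f : L0 n}
    (hf : Tendsto (fun r => m f p q r) l (𝓝 0)) :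
    Tendsto (fun r => m (c • f) p q r) l (𝓝 0) := by
  simp only [m_smul hq]
  simpa using ENNReal.Tendsto.const_mul hf (Or.inr (enorm_ne_top (x := c)))

/-- The vanishing Morrey space at the origin, `V₀𝓜^p_q`, with the Morrey norm. -/
def V0 (n : ℕ) (p q : ℝ) [hq : Fact (1 ≤ q)] : Submodule ℂ (space n p q) where
  carrier := {f | Tendsto (fun r => m (f : L0 n) p q r) (𝓝[>] 0) (𝓝 0)}
  zero_mem' := by simp [m_zero hq.out]
  add_mem' hf hg := tendsto_m_add hq.out hf hg
  smul_mem' c _ hf := tendsto_m_smul hq.out c hf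

/-- The vanishing Morrey space at infinity, `V_∞𝓜^p_q`, with the Morrey norm. -/
def VInfty (n : ℕ) (p q : ℝ) [hq : Fact (1 ≤ q)] : Submodule ℂ (space n p q) where
  carrier := {f | Tendsto (fun r => m (f : L0 n) p q r) atTop (𝓝 0)}
  zero_mem' := by simp [m_zero hq.out]
  add_mem' hf hg := tendsto_m_add hq.out hf hg
  smul_mem' c _ hf := tendsto_m_smul hq.out c hf

/-- The space `V^{(*)}𝓜^p_q`, with the Morrey norm. -/
def VStar (n : ℕ) (p q : ℝ) [hq : Fact (1 ≤ q)] : Submodule ℂ (space n p q) where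
  carrier := {f | Tendsto (fun N : ℕ => tail (f : L0 n) q N) atTop (𝓝 0)}
  zero_mem' := by simp [tail_zero hq.out]
  add_mem' {f g} hf hg := by
    have hc : (2 : ℝ≥0∞) ^ (q - 1) ≠ ∞ :=
      (ENNReal.rpow_lt_top_of_nonneg (by linarith [hq.out]) (by simp)).ne
    refine tendsto_of_tendsto_of_tendsto_of_le_of_le tendsto_const_nhds
      (h := fun N => 2 ^ (q - 1) * (tail (f : L0 n) q N + tail (g : L0 n) q N)) ?_
      (fun _ => zero_le) (fun N => tail_add_le hq.out _ _ N)
    simpa using ENNReal.Tendsto.const_mul (hf.add hg) (Or.inr hc)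
  smul_mem' c f hf := by
    have hq0 : 0 ≤ q := by linarith [hq.out]
    have hc : ‖c‖ₑ ^ q ≠ ∞ := by finiteness
    change Tendsto (fun N : ℕ => tail (c • (f : L0 n)) q N) atTop (𝓝 0)
    simp only [tail_smul hq.out]
    simpa using ENNReal.Tendsto.const_mul hf (Or.inr hc)

/-- The embedding in the ambient space of measurable functions of a subspace of a Morrey space. -/
def incl {n : ℕ} {p q : ℝ} [Fact (1 ≤ q)] (V : Submodule ℂ (space n p q)) : V →ₗ[ℂ] L0 n :=
  (space n p q).subtype ∘ₗ V.subtype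

/-- The function `x ↦ |x|^{-n/p}` on `ℝⁿ`. -/
def f3 (n : ℕ) (p : ℝ) : L0 n :=
  AEEqFun.mk (fun x : EuclideanSpace ℝ (Fin n) => ((‖x‖ ^ (-(n : ℝ) / p) : ℝ) : ℂ))
    (Complex.measurable_ofReal.comp (measurable_norm.pow_const _)).aestronglyMeasurable

end Morrey

end

open Morrey ComplexInterpolation

/-!
# The power `|x|^{-n/p}` between vanishing Morrey spaces

Write `δ = n/p₀ - n/p₁`, so that `|x|^{-n/p₀} e^{zv}` with `v = δ log |x|` runs through the complex
powers of `|x|`; it is `|x|^{-n/p}` at `z = θ` and has the modulus of `|x|^{-n/p₀}` and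
`|x|^{-n/p₁}` on the two edges of the strip.

*Membership in the second space.* The pure powers `|x|^{-n/p₀}` and `|x|^{-n/p₁}` are in the Morrey
spaces but their Morrey averages do not vanish at `0` or at `∞`. A primitive in `z` of the family
gains a factor `1/v`, which tends to zero at both ends; multiplying a power by a bounded function of
`v` that vanishes at `±∞` gives an element of each of the three vanishing subspaces
(`modulatedPower_mem_V0`, `modulatedPower_mem_VInfty`, `modulatedPower_mem_VStar`). All norm
estimates for the primitive thus reduce to sup norm estimates for scalar kernels on the line
(`mem_secondSpace_of_embedding`).

*Non-membership in the first space.* This holds for arbitrary subspaces of the two Morrey spaces.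
Ball averages over `B(0, r)` are functionals of norm at most `e^{-Λ/p₀}` and `e^{-Λ/p₁}`, where
`Λ = log |B(0, r)|`. For `F` in the first functor, `e^{Λ((1-z)/p₀ + z/p₁)} e^{z²} ℓ(F z)` is then
bounded on the strip uniformly in `r`. Translation by `iτ`, where `τ = π/(Λ (1/p₁ - 1/p₀))`, changes
the sign of the first exponential, whereas the boundary values of `e^{z²} F(z)` are uniformly
continuous in norm (the Gaussian factor serves this purpose only) and barely change; by the three
lines theorem the function nearly changes sign inside the strip as well, and by Cauchy's
estimate it barely changes. So it is small (`MemF.eventually_norm_le`). At `z = θ` this contradicts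
that the averages of `|x|^{-n/p}` are at least `r^{-n/p}`.
-/

namespace ComplexInterpolation

/-! ### Scalar functions on the strip -/

theorem closure_strip : closure strip = closedStrip := by
  have h : strip = Complex.re ⁻¹' Ioo 0 1 := rfl
  rw [h, Complex.closure_preimage_re, closure_Ioo zero_ne_one]
  rfl

theorem isOpen_strip : IsOpen strip :=
  isOpen_Ioo.preimage Complex.continuous_re

theorem strip_subset_closedStrip : strip ⊆ closedStrip := fun _ hz => ⟨hz.1.le, hz.2.le⟩

theorem norm_le_of_boundary {h : ℂ → ℂ} {B C : ℝ} (hc : ContinuousOn h closedStrip)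
    (hd : DifferentiableOn ℂ h strip) (hB : ∀ z ∈ closedStrip, ‖h z‖ ≤ B)
    (h0 : ∀ t : ℝ, ‖h (t * Complex.I)‖ ≤ C) (h1 : ∀ t : ℝ, ‖h (1 + t * Complex.I)‖ ≤ C)
    {z : ℂ} (hz : z ∈ closedStrip) : ‖h z‖ ≤ C := by
  refine PhragmenLindelof.vertical_strip (a := 0) (b := 1) (f := h) ⟨hd, ?_⟩
    ⟨0, by positivity, 0, ?_⟩ ?_ ?_ hz.1 hz.2
  · exact (closure_strip ▸ hc : ContinuousOn h (closure strip))
  · refine Asymptotics.IsBigO.of_bound B ?_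
    filter_upwards [mem_inf_of_right (mem_principal_self _)] with w hw
    simpa using hB w (strip_subset_closedStrip hw)
  · intro w hw
    have := h0 w.im
    rwa [show (w.im : ℂ) * Complex.I = w by apply Complex.ext <;> simp [hw]] at this
  · intro w hw
    have := h1 w.im
    rwa [show 1 + (w.im : ℂ) * Complex.I = w by apply Complex.ext <;> simp [hw]] at this

/-- A function on the strip that nearly changes sign under a short vertical translation is small:
by Cauchy's estimate it hardly changes under that translation. -/
theorem norm_le_of_antiperiodic {h : ℂ → ℂ} {B C ε τ θ ρ : ℝ} (hc : ContinuousOn h closedStrip)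
    (hd : DifferentiableOn ℂ h strip) (hB : ∀ z ∈ closedStrip, ‖h z‖ ≤ B)
    (h0 : ∀ t : ℝ, ‖h (t * Complex.I)‖ ≤ C) (h1 : ∀ t : ℝ, ‖h (1 + t * Complex.I)‖ ≤ C)
    (h0' : ∀ t : ℝ, ‖h (t * Complex.I) + h ((t + τ : ℝ) * Complex.I)‖ ≤ ε)
    (h1' : ∀ t : ℝ, ‖h (1 + t * Complex.I) + h (1 + (t + τ : ℝ) * Complex.I)‖ ≤ ε)
    (hρ : 0 < ρ) (hρ0 : ρ < θ) (hρ1 : ρ < 1 - θ) :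
    2 * ‖h θ‖ ≤ ε + C / ρ * |τ| := by
  have hshift : ∀ z : ℂ, (z + τ * Complex.I).re = z.re := by intro z; simp
  have hsum : ‖h θ + h (θ + τ * Complex.I)‖ ≤ ε := by
    refine norm_le_of_boundary (h := fun z => h z + h (z + τ * Complex.I)) (B := B + B)
      (hc.add (hc.comp (by fun_prop) ?_)) (hd.add (hd.comp (by fun_prop) ?_)) ?_ ?_ ?_ ?_
    · intro z hz
      simpa [closedStrip, hshift] using hz
    · intro z hz
      simpa [strip, hshift] using hz
    · intro z hz
      refine (norm_add_le _ _).trans (add_le_add (hB z hz) (hB _ ?_))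
      simpa [closedStrip, hshift] using hz
    · intro t
      convert h0' t using 3
      push_cast; ring_nf
    · intro t
      convert h1' t using 3
      push_cast; ring_nf
    · simp only [closedStrip, mem_ofPred_eq, Complex.ofReal_re]
      constructor <;> linarith
  have hC : ∀ z ∈ closedStrip, ‖h z‖ ≤ C := fun z hz => norm_le_of_boundary hc hd hB h0 h1 hz
  have hderiv : ∀ z ∈ {z : ℂ | z.re = θ}, ‖deriv h z‖ ≤ C / ρ := by
    intro z hz
    have hsub : closedBall z ρ ⊆ strip := by
      intro w hw
      have h2 : |w.re - z.re| ≤ ρ := by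
        rw [← Complex.sub_re]
        exact (Complex.abs_re_le_norm _).trans (by simpa [dist_eq_norm] using hw)
      rw [show z.re = θ from hz, abs_le] at h2
      constructor <;> linarith
    refine Complex.norm_deriv_le_of_forall_mem_sphere_norm_le hρ
      ((hd.mono ?_).diffContOnCl) fun w hw =>
        hC w (strip_subset_closedStrip (hsub (sphere_subset_closedBall hw)))
    exact closure_ball_subset_closedBall.trans hsub
  have hconv : Convex ℝ {z : ℂ | z.re = θ} := convex_hyperplane Complex.reLm.isLinear θ
  have hmv : ‖h (θ + τ * Complex.I) - h θ‖ ≤ C / ρ * ‖(θ + τ * Complex.I : ℂ) - θ‖ := by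
    refine hconv.norm_image_sub_le_of_norm_deriv_le (fun z hz => ?_) hderiv (by simp) (by simp)
    refine hd.differentiableAt (isOpen_strip.mem_nhds ?_)
    have hz : z.re = θ := hz
    constructor <;> linarith
  rw [add_sub_cancel_left, norm_mul, Complex.norm_I, mul_one, Complex.norm_real,
    Real.norm_eq_abs] at hmv
  calc 2 * ‖h θ‖ = ‖(h θ + h (θ + τ * Complex.I)) - (h (θ + τ * Complex.I) - h θ)‖ := by
        rw [show (h θ + h (θ + τ * Complex.I)) - (h (θ + τ * Complex.I) - h θ) = 2 * h θ by ring]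
        simp
    _ ≤ _ := (norm_sub_le _ _).trans (add_le_add hsum hmv)

/-! ### Decay of functionals along the first interpolation space -/

section Decay

variable {X₀ X₁ Z : Type*} [NormedAddCommGroup X₀] [NormedSpace ℂ X₀]
  [NormedAddCommGroup X₁] [NormedSpace ℂ X₁] [AddCommGroup Z] [Module ℂ Z]
  {ι₀ : X₀ →ₗ[ℂ] Z} {ι₁ : X₁ →ₗ[ℂ] Z}

theorem SumSpace.left_smul (c : ℂ) (x : X₀) :
    SumSpace.left ι₀ ι₁ (c • x) = c • SumSpace.left ι₀ ι₁ x := by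
  rw [SumSpace.left, SumSpace.left, ← map_smul, ← WithLp.toLp_smul, Prod.smul_mk, smul_zero]

theorem SumSpace.right_smul (c : ℂ) (x : X₁) :
    SumSpace.right ι₀ ι₁ (c • x) = c • SumSpace.right ι₀ ι₁ x := by
  rw [SumSpace.right, SumSpace.right, ← map_smul, ← WithLp.toLp_smul, Prod.smul_mk, smul_zero]

theorem SumSpace.left_add (x y : X₀) :
    SumSpace.left ι₀ ι₁ (x + y) = SumSpace.left ι₀ ι₁ x + SumSpace.left ι₀ ι₁ y := by
  rw [SumSpace.left, SumSpace.left, SumSpace.left, ← map_add, ← WithLp.toLp_add, Prod.mk_add_mk,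
    add_zero]

theorem SumSpace.right_add (x y : X₁) :
    SumSpace.right ι₀ ι₁ (x + y) = SumSpace.right ι₀ ι₁ x + SumSpace.right ι₀ ι₁ y := by
  rw [SumSpace.right, SumSpace.right, SumSpace.right, ← map_add, ← WithLp.toLp_add, Prod.mk_add_mk,
    add_zero]

theorem hasFDerivWithinAt_clm_comp {E F : Type*} [SeminormedAddCommGroup E] [NormedSpace ℂ E]
    [SeminormedAddCommGroup F] [NormedSpace ℂ F] (ℓ : E →L[ℂ] F) {f : ℂ → E} {f' : ℂ →L[ℂ] E}
    {s : Set ℂ} {z : ℂ} (hf : HasFDerivWithinAt f f' s z) :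
    HasFDerivWithinAt (fun w => ℓ (f w)) (ℓ ∘L f') s z := by
  rw [hasFDerivWithinAt_iff_isLittleO] at hf ⊢
  refine ((ℓ.isBigO_comp _ _).trans_isLittleO hf).congr_left fun w => ?_
  simp

theorem norm_cexp_sq_le {z : ℂ} (hz : z ∈ closedStrip) :
    ‖Complex.exp (z ^ 2)‖ ≤ Real.exp (1 - z.im ^ 2) := by
  rw [Complex.norm_exp, Real.exp_le_exp, pow_two, Complex.mul_re]
  nlinarith [hz.1, hz.2]

/-- A bounded continuous function, multiplied by a function dominated by a Gaussian, is
uniformly continuous. -/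
theorem uniformContinuous_smul_gaussian {E : Type*} [NormedAddCommGroup E] [NormedSpace ℂ E]
    {f : ℝ → E} {g : ℝ → ℂ} {C : ℝ} (hf : Continuous f) (hg : Continuous g)
    (hC : ∀ t, ‖f t‖ ≤ C) (hgauss : ∀ t, ‖g t‖ ≤ Real.exp (1 - t ^ 2)) :
    UniformContinuous fun t => g t • f t := by
  refine (hg.smul hf).uniformContinuous_of_tendsto_cocompact (x := 0) ?_
  have h1 : Tendsto (fun t : ℝ => 1 - t ^ 2) (cocompact ℝ) atBot := by
    have : Tendsto (fun t : ℝ => ‖t‖ ^ 2) (cocompact ℝ) atTop :=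
      (tendsto_pow_atTop two_ne_zero).comp (tendsto_norm_cocompact_atTop (E := ℝ))
    simp only [Real.norm_eq_abs, sq_abs] at this
    simpa [sub_eq_add_neg] using
      tendsto_atBot_add_const_left _ (1 : ℝ) (tendsto_neg_atTop_atBot.comp this)
  have h2 : Tendsto (fun t : ℝ => Real.exp (1 - t ^ 2) * C) (cocompact ℝ) (𝓝 0) := by
    simpa using (Real.tendsto_exp_atBot.comp h1).mul_const C
  refine squeeze_zero_norm (fun t => ?_) h2
  rw [norm_smul]
  exact mul_le_mul (hgauss t) (hC t) (norm_nonneg _) (Real.exp_nonneg _)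

/-- Functionals whose norms on the two spaces decay at different exponential rates decay faster
on `[X₀, X₁]_θ` than the interpolated rate predicts, because the boundary values of `F` are norm
continuous while the interpolating exponential factor oscillates with frequency `Λ (a₁ - a₀)`. -/
theorem MemF.eventually_norm_le {F : ℂ → SumSpace ι₀ ι₁} (hF : MemF ι₀ ι₁ F) {θ : ℝ} (hθ : 0 < θ)
    (hθ' : θ < 1) {a₀ a₁ : ℝ} (ha : a₀ ≠ a₁) {ε : ℝ} (hε : 0 < ε) :
    ∀ᶠ Λ : ℝ in atTop, ∀ ℓ : SumSpace ι₀ ι₁ →L[ℂ] ℂ,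
      (∀ x, ‖ℓ (SumSpace.left ι₀ ι₁ x)‖ ≤ Real.exp (-Λ * a₀) * ‖x‖) →
      (∀ x, ‖ℓ (SumSpace.right ι₀ ι₁ x)‖ ≤ Real.exp (-Λ * a₁) * ‖x‖) →
      Real.exp (Λ * ((1 - θ) * a₀ + θ * a₁)) * ‖ℓ (F θ)‖ ≤ ε := by
  obtain ⟨f₀, hf₀c, ⟨C₀, hC₀⟩, hf₀⟩ := hF.boundary₀
  obtain ⟨f₁, hf₁c, ⟨C₁, hC₁⟩, hf₁⟩ := hF.boundary₁
  obtain ⟨B, hB⟩ := hF.bounded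
  have him : ∀ t : ℝ, (t * Complex.I : ℂ) ∈ closedStrip := fun t => by simp [closedStrip]
  have him' : ∀ t : ℝ, (1 + t * Complex.I : ℂ) ∈ closedStrip := fun t => by simp [closedStrip]
  have hg₀ : ∀ t : ℝ, ‖Complex.exp ((t * Complex.I) ^ 2)‖ ≤ Real.exp (1 - t ^ 2) := fun t => by
    simpa using norm_cexp_sq_le (him t)
  have hg₁ : ∀ t : ℝ, ‖Complex.exp ((1 + t * Complex.I) ^ 2)‖ ≤ Real.exp (1 - t ^ 2) := fun t => by
    simpa using norm_cexp_sq_le (him' t)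
  have hu₀ := uniformContinuous_smul_gaussian hf₀c (by fun_prop) hC₀ hg₀
  have hu₁ := uniformContinuous_smul_gaussian hf₁c (by fun_prop) hC₁ hg₁
  obtain ⟨δ₀, hδ₀, hu₀⟩ := Metric.uniformContinuous_iff.1 hu₀ ε hε
  obtain ⟨δ₁, hδ₁, hu₁⟩ := Metric.uniformContinuous_iff.1 hu₁ ε hε
  set C : ℝ := Real.exp 1 * max C₀ C₁ with hCdef
  set ρ : ℝ := min θ (1 - θ) / 2 with hρdef
  have hmin : 0 < min θ (1 - θ) := lt_min hθ (by linarith)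
  have hρ : 0 < ρ := by positivity
  have hρ0 : ρ < θ := by have := min_le_left θ (1 - θ); linarith
  have hρ1 : ρ < 1 - θ := by have := min_le_right θ (1 - θ); linarith
  have hd : a₁ - a₀ ≠ 0 := sub_ne_zero.2 ha.symm
  have hτ : Tendsto (fun Λ : ℝ => Real.pi / (Λ * (a₁ - a₀))) atTop (𝓝 0) := by
    have := (tendsto_inv_atTop_zero (𝕜 := ℝ)).const_mul (Real.pi / (a₁ - a₀))
    rw [mul_zero] at this
    refine this.congr fun Λ => ?_
    rw [div_eq_mul_inv, div_eq_mul_inv, mul_inv]; ring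
  have hτ' : Tendsto (fun Λ : ℝ => C / ρ * |Real.pi / (Λ * (a₁ - a₀))|) atTop (𝓝 0) := by
    simpa using hτ.abs.const_mul (C / ρ)
  have hτabs : Tendsto (fun Λ : ℝ => |Real.pi / (Λ * (a₁ - a₀))|) atTop (𝓝 0) := by
    simpa using hτ.abs
  filter_upwards [eventually_gt_atTop 0, hτ'.eventually (ge_mem_nhds hε),
    hτabs.eventually (gt_mem_nhds hδ₀), hτabs.eventually (gt_mem_nhds hδ₁)]
    with Λ hΛ h1 h2 h3 ℓ hℓ₀ hℓ₁
  set τ : ℝ := Real.pi / (Λ * (a₁ - a₀)) with hτdef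
  have hτeq : Λ * (a₁ - a₀) * τ = Real.pi := by
    rw [hτdef, mul_div_cancel₀ _ (mul_ne_zero hΛ.ne' hd)]
  -- The exponential factor; translation by `iτ` changes its sign.
  set e : ℂ → ℂ := fun z => Complex.exp (Λ * ((1 - z) * a₀ + z * a₁)) with hedef
  have henorm : ∀ z, ‖e z‖ = Real.exp (Λ * ((1 - z.re) * a₀ + z.re * a₁)) := by
    intro z
    rw [hedef, Complex.norm_exp]
    simp
  have hesign : ∀ z, e (z + τ * Complex.I) = -e z := by
    intro z
    have : (Λ * ((1 - (z + τ * Complex.I)) * a₀ + (z + τ * Complex.I) * a₁) : ℂ) =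
        Λ * ((1 - z) * a₀ + z * a₁) + Real.pi * Complex.I := by
      rw [← hτeq]; push_cast; ring
    simp only [hedef]
    rw [this, Complex.exp_add, Complex.exp_pi_mul_I, mul_neg_one]
  set h : ℂ → ℂ := fun z => e z * (Complex.exp (z ^ 2) * ℓ (F z)) with hhdef
  have he₀ : ∀ t : ℝ, ‖e (t * Complex.I)‖ = Real.exp (Λ * a₀) := fun t => by simp [henorm]
  have he₁ : ∀ t : ℝ, ‖e (1 + t * Complex.I)‖ = Real.exp (Λ * a₁) := fun t => by simp [henorm]
  have hb₀ : ∀ (t : ℝ) (x : X₀), ‖e (t * Complex.I) * ℓ (SumSpace.left ι₀ ι₁ x)‖ ≤ ‖x‖ := by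
    intro t x
    rw [norm_mul, he₀]
    calc _ ≤ Real.exp (Λ * a₀) * (Real.exp (-Λ * a₀) * ‖x‖) := by gcongr; exact hℓ₀ x
      _ = ‖x‖ := by rw [← mul_assoc, ← Real.exp_add]; simp
  have hb₁ : ∀ (t : ℝ) (x : X₁), ‖e (1 + t * Complex.I) * ℓ (SumSpace.right ι₀ ι₁ x)‖ ≤ ‖x‖ := by
    intro t x
    rw [norm_mul, he₁]
    calc _ ≤ Real.exp (Λ * a₁) * (Real.exp (-Λ * a₁) * ‖x‖) := by gcongr; exact hℓ₁ x
      _ = ‖x‖ := by rw [← mul_assoc, ← Real.exp_add]; simp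
  have hh₀ : ∀ t : ℝ, h (t * Complex.I) = e (t * Complex.I) *
      ℓ (SumSpace.left ι₀ ι₁ (Complex.exp ((t * Complex.I) ^ 2) • f₀ t)) := fun t => by
    rw [hhdef, SumSpace.left_smul, map_smul, smul_eq_mul, ← hf₀]
  have hh₁ : ∀ t : ℝ, h (1 + t * Complex.I) = e (1 + t * Complex.I) *
      ℓ (SumSpace.right ι₀ ι₁ (Complex.exp ((1 + t * Complex.I) ^ 2) • f₁ t)) := fun t => by
    rw [hhdef, SumSpace.right_smul, map_smul, smul_eq_mul, ← hf₁]
  have hgauss : ∀ t : ℝ, Real.exp (1 - t ^ 2) ≤ Real.exp 1 := fun t =>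
    Real.exp_le_exp.2 (by nlinarith [sq_nonneg t])
  have hcont : ContinuousOn h closedStrip := by
    have : Continuous e := by fun_prop
    exact this.continuousOn.mul (ContinuousOn.mul (by fun_prop)
      (ℓ.continuous.comp_continuousOn hF.continuousOn))
  have hdiff : DifferentiableOn ℂ h strip := by
    have he : Differentiable ℂ e := by
      simp only [hedef]; fun_prop
    refine he.differentiableOn.mul (DifferentiableOn.mul (by fun_prop) fun z hz => ?_)
    exact (hasFDerivWithinAt_clm_comp ℓ
      (hF.holomorphic z hz).hasFDerivWithinAt).differentiableWithinAt
  have hbound : ∀ z ∈ closedStrip, ‖h z‖ ≤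
      Real.exp (Λ * (|a₀| + |a₁|)) * (Real.exp 1 * (‖ℓ‖ * B)) := by
    intro z hz
    rw [hhdef, norm_mul, norm_mul, henorm]
    have h5 : (1 - z.re) * a₀ + z.re * a₁ ≤ |a₀| + |a₁| := by
      have h6 := hz.1
      have h7 := hz.2
      nlinarith [le_abs_self a₀, le_abs_self a₁, abs_nonneg a₀, abs_nonneg a₁]
    gcongr
    · refine (norm_cexp_sq_le hz).trans (hgauss _)
    · exact (ℓ.le_opNorm _).trans (by gcongr; exact hB z hz)
  have main := norm_le_of_antiperiodic (C := C) (ε := ε) (τ := τ) (θ := θ) (ρ := ρ)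
    hcont hdiff hbound ?_ ?_ ?_ ?_ hρ hρ0 hρ1
  · have h8 : Real.exp (Λ * ((1 - θ) * a₀ + θ * a₁)) * ‖ℓ (F θ)‖ ≤ ‖h θ‖ := by
      rw [hhdef, norm_mul, norm_mul, henorm, Complex.ofReal_re]
      have : 1 ≤ ‖Complex.exp ((θ : ℂ) ^ 2)‖ := by
        rw [← Complex.ofReal_pow, Complex.norm_exp, Complex.ofReal_re]
        exact Real.one_le_exp (sq_nonneg θ)
      gcongr
      exact le_mul_of_one_le_left (norm_nonneg _) this
    linarith
  · intro t
    rw [hh₀]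
    refine (hb₀ _ _).trans ?_
    rw [norm_smul]
    exact mul_le_mul ((hg₀ t).trans (hgauss t)) ((hC₀ t).trans (le_max_left _ _))
      (norm_nonneg _) (Real.exp_nonneg _)
  · intro t
    rw [hh₁]
    refine (hb₁ _ _).trans ?_
    rw [norm_smul]
    exact mul_le_mul ((hg₁ t).trans (hgauss t)) ((hC₁ t).trans (le_max_right _ _))
      (norm_nonneg _) (Real.exp_nonneg _)
  · intro t
    have h9 : e ((t + τ : ℝ) * Complex.I) = -e (t * Complex.I) := by
      rw [← hesign]; push_cast; ring_nf
    have h10 := hb₀ t (Complex.exp ((t * Complex.I) ^ 2) • f₀ t +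
      (-1 : ℂ) • Complex.exp (((t + τ : ℝ) * Complex.I) ^ 2) • f₀ (t + τ))
    rw [SumSpace.left_add, SumSpace.left_smul (-1), map_add, map_smul, mul_add] at h10
    rw [hh₀, hh₀, h9]
    refine le_trans (le_of_eq ?_) (h10.trans ?_)
    · congr 2
      simp
    · have := hu₀ (a := t) (b := t + τ) (by simpa [Real.dist_eq] using h2)
      rw [dist_eq_norm, sub_eq_add_neg] at this
      simpa using this.le
  · intro t
    have h9 : e (1 + (t + τ : ℝ) * Complex.I) = -e (1 + t * Complex.I) := by
      rw [← hesign]; push_cast; ring_nf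
    have h10 := hb₁ t (Complex.exp ((1 + t * Complex.I) ^ 2) • f₁ t +
      (-1 : ℂ) • Complex.exp ((1 + (t + τ : ℝ) * Complex.I) ^ 2) • f₁ (t + τ))
    rw [SumSpace.right_add, SumSpace.right_smul (-1), map_add, map_smul, mul_add] at h10
    rw [hh₁, hh₁, h9]
    refine le_trans (le_of_eq ?_) (h10.trans ?_)
    · congr 2
      simp
    · have := hu₁ (a := t) (b := t + τ) (by simpa [Real.dist_eq] using h3)
      rw [dist_eq_norm, sub_eq_add_neg] at this
      simpa using this.le

end Decay

end ComplexInterpolation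

namespace Morrey

variable {n : ℕ} {p q : ℝ}

/-! ### The Morrey norm of a power -/

theorem volume_ball_eq (hn : 1 ≤ n) (x : EuclideanSpace ℝ (Fin n)) {r : ℝ} (hr : 0 < r) :
    volume (ball x r) = ENNReal.ofReal r ^ (n : ℝ) *
      volume (ball (0 : EuclideanSpace ℝ (Fin n)) 1) := by
  have : Nonempty (Fin n) := ⟨⟨0, hn⟩⟩
  rw [Measure.addHaar_ball _ _ hr.le, finrank_euclideanSpace, Fintype.card_fin,
    ENNReal.ofReal_pow hr.le, ENNReal.rpow_natCast]

theorem lintegral_ball_zero_one_rpow_lt_top (hn : 1 ≤ n) {s : ℝ} (hs : s < n) :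
    ∫⁻ y in ball (0 : EuclideanSpace ℝ (Fin n)) 1, ENNReal.ofReal (‖y‖ ^ (-s)) < ∞ := by
  have : Nonempty (Fin n) := ⟨⟨0, hn⟩⟩
  have h : IntegrableOn (fun y : EuclideanSpace ℝ (Fin n) => ‖y‖ ^ (-s)) (ball 0 1) volume := by
    rw [integrableOn_fun_norm_addHaar volume (f := fun t : ℝ => t ^ (-s))]
    have h1 : IntegrableOn (fun t : ℝ => t ^ ((n : ℝ) - 1 - s)) (Ioo 0 1) :=
      (intervalIntegral.integrableOn_Ioo_rpow_iff zero_lt_one).2 (by linarith)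
    refine h1.congr_fun (fun t ht => ?_) measurableSet_Ioo
    have : ((Module.finrank ℝ (EuclideanSpace ℝ (Fin n)) - 1 : ℕ) : ℝ) = (n : ℝ) - 1 := by
      rw [finrank_euclideanSpace, Fintype.card_fin, Nat.cast_sub hn, Nat.cast_one]
    rw [smul_eq_mul, ← Real.rpow_natCast, this, ← Real.rpow_add ht.1, sub_eq_add_neg _ s]
  have := h.lintegral_lt_top
  simpa using this

theorem lintegral_ball_zero_rpow {s r : ℝ} (hr : 0 < r) :
    ∫⁻ y in ball (0 : EuclideanSpace ℝ (Fin n)) r, ENNReal.ofReal (‖y‖ ^ (-s)) =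
      ENNReal.ofReal r ^ (n : ℝ) * ENNReal.ofReal (r ^ (-s)) *
      ∫⁻ y in ball (0 : EuclideanSpace ℝ (Fin n)) 1, ENNReal.ofReal (‖y‖ ^ (-s)) := by
  set F : EuclideanSpace ℝ (Fin n) → ℝ≥0∞ :=
    (ball 0 r).indicator fun y => ENNReal.ofReal (‖y‖ ^ (-s)) with hF
  have hFm : Measurable F := by
    refine Measurable.indicator ?_ measurableSet_ball
    exact (measurable_norm.pow_const _).ennreal_ofReal
  have h1 : ∫⁻ x, F (r • x) = ENNReal.ofReal (|(r ^ n)⁻¹|) * ∫⁻ y, F y := by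
    rw [← lintegral_map hFm (measurable_const_smul r), Measure.map_addHaar_smul _ hr.ne',
      lintegral_smul_measure, finrank_euclideanSpace, Fintype.card_fin, smul_eq_mul]
  have h2 : ∀ x, F (r • x) = ENNReal.ofReal (r ^ (-s)) *
      (ball 0 1).indicator (fun y => ENNReal.ofReal (‖y‖ ^ (-s))) x := by
    intro x
    by_cases hx : x ∈ ball (0 : EuclideanSpace ℝ (Fin n)) 1
    · have hx' : r • x ∈ ball (0 : EuclideanSpace ℝ (Fin n)) r := by
        rw [mem_ball_zero_iff] at hx ⊢
        rw [norm_smul, Real.norm_of_nonneg hr.le]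
        nlinarith
      rw [hF, indicator_of_mem hx, indicator_of_mem hx', norm_smul, Real.norm_of_nonneg hr.le,
        Real.mul_rpow hr.le (norm_nonneg _), ENNReal.ofReal_mul (by positivity)]
    · have hx' : r • x ∉ ball (0 : EuclideanSpace ℝ (Fin n)) r := by
        rw [mem_ball_zero_iff, not_lt] at hx ⊢
        rw [norm_smul, Real.norm_of_nonneg hr.le]
        nlinarith
      rw [hF, indicator_of_notMem hx, indicator_of_notMem hx', mul_zero]
  simp only [h2] at h1
  rw [lintegral_const_mul' _ _ ENNReal.ofReal_ne_top, lintegral_indicator measurableSet_ball,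
    hF, lintegral_indicator measurableSet_ball] at h1
  rw [mul_assoc, h1, ← mul_assoc, abs_of_pos (by positivity), ENNReal.rpow_natCast,
    ← ENNReal.ofReal_pow hr.le, ← ENNReal.ofReal_mul (by positivity),
    mul_inv_cancel₀ (by positivity), ENNReal.ofReal_one, one_mul]

/-- On any ball of radius `r` the power `|y|^{-s}` is at most `r^{-s}` outside `B(0, r)`, so that
centering the ball at the singularity is the worst case up to a constant. -/
theorem lintegral_ball_rpow_le (hn : 1 ≤ n) {s r : ℝ} (hs : 0 ≤ s) (hr : 0 < r)
    (x : EuclideanSpace ℝ (Fin n)) :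
    ∫⁻ y in ball x r, ENNReal.ofReal (‖y‖ ^ (-s)) ≤
      ENNReal.ofReal r ^ (n : ℝ) * ENNReal.ofReal (r ^ (-s)) *
      ((∫⁻ y in ball (0 : EuclideanSpace ℝ (Fin n)) 1, ENNReal.ofReal (‖y‖ ^ (-s))) +
        volume (ball (0 : EuclideanSpace ℝ (Fin n)) 1)) := by
  have h1 : ∀ y : EuclideanSpace ℝ (Fin n), ENNReal.ofReal (‖y‖ ^ (-s)) ≤
      (ball 0 r).indicator (fun y => ENNReal.ofReal (‖y‖ ^ (-s))) y + ENNReal.ofReal (r ^ (-s)) := by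
    intro y
    by_cases hy : y ∈ ball (0 : EuclideanSpace ℝ (Fin n)) r
    · rw [indicator_of_mem hy]
      exact le_self_add
    · rw [indicator_of_notMem hy, zero_add]
      rw [mem_ball_zero_iff, not_lt] at hy
      exact ENNReal.ofReal_le_ofReal (Real.rpow_le_rpow_of_nonpos hr hy (by linarith))
  calc ∫⁻ y in ball x r, ENNReal.ofReal (‖y‖ ^ (-s))
      ≤ ∫⁻ y in ball x r, ((ball 0 r).indicator (fun y => ENNReal.ofReal (‖y‖ ^ (-s))) y +
          ENNReal.ofReal (r ^ (-s))) := lintegral_mono h1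
    _ = (∫⁻ y in ball x r, (ball 0 r).indicator (fun y => ENNReal.ofReal (‖y‖ ^ (-s))) y) +
          ENNReal.ofReal (r ^ (-s)) * volume (ball x r) := by
        rw [lintegral_add_right _ measurable_const, setLIntegral_const]
    _ ≤ (∫⁻ y in ball (0 : EuclideanSpace ℝ (Fin n)) r, ENNReal.ofReal (‖y‖ ^ (-s))) +
          ENNReal.ofReal (r ^ (-s)) * volume (ball x r) := by
        refine add_le_add_left ?_ _
        rw [← lintegral_indicator measurableSet_ball (fun y => ENNReal.ofReal (‖y‖ ^ (-s)))]
        exact setLIntegral_le_lintegral _ _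
    _ = _ := by
        rw [lintegral_ball_zero_rpow hr, volume_ball_eq hn x hr]
        ring

theorem coeFn_f3 (n : ℕ) (p : ℝ) : f3 n p =ᵐ[volume]
    fun x : EuclideanSpace ℝ (Fin n) => ((‖x‖ ^ (-(n : ℝ) / p) : ℝ) : ℂ) :=
  AEEqFun.coeFn_mk _ _

theorem enorm_power_rpow (hq : 1 ≤ q) (y : EuclideanSpace ℝ (Fin n)) :
    ‖((‖y‖ ^ (-(n : ℝ) / p) : ℝ) : ℂ)‖ₑ ^ q = ENNReal.ofReal (‖y‖ ^ (-(n * q / p))) := by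
  have h : 0 ≤ ‖y‖ ^ (-(n : ℝ) / p) := Real.rpow_nonneg (norm_nonneg _) _
  rw [← ofReal_norm, Complex.norm_real, Real.norm_of_nonneg h,
    ENNReal.ofReal_rpow_of_nonneg h (by linarith), ← Real.rpow_mul (norm_nonneg _)]
  congr 2
  ring

theorem eNorm_f3_lt_top (hn : 1 ≤ n) (hq : 1 ≤ q) (hqp : q < p) : eNorm (f3 n p) p q < ∞ := by
  have hn0 : (0 : ℝ) < n := by exact_mod_cast hn
  have hp0 : 0 < p := by linarith
  have hq0 : 0 < q := by linarith
  set s : ℝ := n * q / p with hs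
  have hs0 : 0 ≤ s := by positivity
  have hsn : s < n := by
    rw [hs, div_lt_iff₀ hp0]
    exact mul_lt_mul_of_pos_left hqp hn0
  set β := volume (ball (0 : EuclideanSpace ℝ (Fin n)) 1) with hβ
  have hβ0 : β ≠ 0 := (measure_ball_pos volume _ one_pos).ne'
  have hβt : β ≠ ∞ := measure_ball_lt_top.ne
  set K := (∫⁻ y in ball (0 : EuclideanSpace ℝ (Fin n)) 1, ENNReal.ofReal (‖y‖ ^ (-s))) + β with hK
  have hKt : K ≠ ∞ := ENNReal.add_ne_top.2 ⟨(lintegral_ball_zero_one_rpow_lt_top hn hsn).ne, hβt⟩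
  refine lt_of_le_of_lt (b := β ^ (1 / p) * (β⁻¹ * K) ^ (1 / q)) ?_ ?_
  · refine iSup₂_le fun r hr => iSup_le fun x => ?_
    have hr0 : ENNReal.ofReal r ≠ 0 := (ENNReal.ofReal_pos.2 hr).ne'
    have hrt : ENNReal.ofReal r ≠ ∞ := ENNReal.ofReal_ne_top
    have h1 : ∫⁻ y in ball x r, ‖f3 n p y‖ₑ ^ q ≤
        ENNReal.ofReal r ^ (n : ℝ) * ENNReal.ofReal (r ^ (-s)) * K := by
      refine le_trans (le_of_eq ?_) (lintegral_ball_rpow_le hn hs0 hr x)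
      refine lintegral_congr_ae (ae_restrict_of_ae ?_)
      filter_upwards [coeFn_f3 n p] with y hy
      rw [hy, enorm_power_rpow hq]
    have hX0 : ENNReal.ofReal r ^ (n : ℝ) ≠ 0 := (ENNReal.rpow_pos (pos_iff_ne_zero.2 hr0) hrt).ne'
    have hXt : ENNReal.ofReal r ^ (n : ℝ) ≠ ∞ := by finiteness
    calc volume (ball x r) ^ (1 / p) *
          ((volume (ball x r))⁻¹ * ∫⁻ y in ball x r, ‖f3 n p y‖ₑ ^ q) ^ (1 / q)
        ≤ (ENNReal.ofReal r ^ (n : ℝ) * β) ^ (1 / p) * ((ENNReal.ofReal r ^ (n : ℝ) * β)⁻¹ *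
          (ENNReal.ofReal r ^ (n : ℝ) * ENNReal.ofReal (r ^ (-s)) * K)) ^ (1 / q) := by
          rw [volume_ball_eq hn x hr]
          gcongr
      _ = (ENNReal.ofReal r ^ (n : ℝ) * β) ^ (1 / p) *
          (ENNReal.ofReal (r ^ (-s)) * (β⁻¹ * K)) ^ (1 / q) := by
          congr 2
          rw [ENNReal.mul_inv (Or.inl hX0) (Or.inl hXt)]
          calc _ = ((ENNReal.ofReal r ^ (n : ℝ))⁻¹ * ENNReal.ofReal r ^ (n : ℝ)) *
                (ENNReal.ofReal (r ^ (-s)) * (β⁻¹ * K)) := by ring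
            _ = _ := by rw [ENNReal.inv_mul_cancel hX0 hXt, one_mul]
      _ = β ^ (1 / p) * (β⁻¹ * K) ^ (1 / q) := by
          rw [ENNReal.mul_rpow_of_nonneg _ _ (by positivity),
            ENNReal.mul_rpow_of_nonneg _ _ (by positivity), ← ENNReal.rpow_mul,
            ← ENNReal.ofReal_rpow_of_pos hr, ← ENNReal.rpow_mul]
          calc _ = (ENNReal.ofReal r ^ ((n : ℝ) * (1 / p)) * ENNReal.ofReal r ^ (-s * (1 / q))) *
                (β ^ (1 / p) * (β⁻¹ * K) ^ (1 / q)) := by ring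
            _ = _ := by
              rw [← ENNReal.rpow_add _ _ hr0 hrt, hs]
              have : (n : ℝ) * (1 / p) + -(n * q / p) * (1 / q) = 0 := by field_simp; ring
              rw [this, ENNReal.rpow_zero, one_mul]
  · have : β⁻¹ ≠ ∞ := ENNReal.inv_ne_top.2 hβ0
    exact (ENNReal.mul_ne_top (ENNReal.rpow_ne_top_of_nonneg (by positivity) hβt)
      (ENNReal.rpow_ne_top_of_nonneg (by positivity) (ENNReal.mul_ne_top this hKt))).lt_top

/-! ### Domination criteria for the vanishing subspaces -/

theorem m_mono (hq : 1 ≤ q) {f g : L0 n} (h : ∀ᵐ y, ‖f y‖ ≤ ‖g y‖) (r : ℝ) :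
    m f p q r ≤ m g p q r := by
  have hq0 : 0 < q := by linarith
  refine iSup_mono fun x => ?_
  have : ∫⁻ y in ball x r, ‖f y‖ₑ ^ q ≤ ∫⁻ y in ball x r, ‖g y‖ₑ ^ q := by
    refine lintegral_mono_ae (ae_restrict_of_ae ?_)
    filter_upwards [h] with y hy
    exact ENNReal.rpow_le_rpow (enorm_le_iff_norm_le.2 hy) hq0.le
  gcongr

theorem eNorm_mono (hq : 1 ≤ q) {f g : L0 n} (h : ∀ᵐ y, ‖f y‖ ≤ ‖g y‖) :
    eNorm f p q ≤ eNorm g p q :=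
  iSup₂_mono fun r _ => m_mono hq h r

/-- The indicator function of the ball `B(0, R)`. -/
noncomputable def ballIndicator (n : ℕ) (R : ℝ) : L0 n :=
  AEEqFun.mk ((ball (0 : EuclideanSpace ℝ (Fin n)) R).indicator fun _ => (1 : ℂ))
    (measurable_const.indicator measurableSet_ball).aestronglyMeasurable

theorem coeFn_ballIndicator (n : ℕ) (R : ℝ) : ballIndicator n R =ᵐ[volume]
    (ball (0 : EuclideanSpace ℝ (Fin n)) R).indicator fun _ => (1 : ℂ) :=
  AEEqFun.coeFn_mk _ _

theorem lintegral_ballIndicator_le (hq : 1 ≤ q) (R r : ℝ) (x : EuclideanSpace ℝ (Fin n)) :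
    ∫⁻ y in ball x r, ‖ballIndicator n R y‖ₑ ^ q ≤ min (volume (ball x r))
      (volume (ball (0 : EuclideanSpace ℝ (Fin n)) R)) := by
  have hq0 : 0 < q := by linarith
  have h : ∫⁻ y in ball x r, ‖ballIndicator n R y‖ₑ ^ q =
      ∫⁻ y in ball x r, (ball (0 : EuclideanSpace ℝ (Fin n)) R).indicator 1 y := by
    refine lintegral_congr_ae (ae_restrict_of_ae ?_)
    filter_upwards [coeFn_ballIndicator n R] with y hy
    rw [hy]
    by_cases hyR : y ∈ ball (0 : EuclideanSpace ℝ (Fin n)) R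
    · simp only [indicator_of_mem hyR, Pi.one_apply, enorm_one, ENNReal.one_rpow]
    · simp only [indicator_of_notMem hyR, enorm_zero, ENNReal.zero_rpow_of_pos hq0]
  rw [h, lintegral_indicator_one measurableSet_ball, Measure.restrict_apply measurableSet_ball]
  exact le_min (measure_mono inter_subset_right) (measure_mono inter_subset_left)

theorem m_ballIndicator_le (hn : 1 ≤ n) (hq : 1 ≤ q) (R : ℝ) {r : ℝ} (hr : 0 < r) :
    m (ballIndicator n R) p q r ≤ volume (ball (0 : EuclideanSpace ℝ (Fin n)) r) ^ (1 / p) := by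
  refine iSup_le fun x => ?_
  have hv : volume (ball x r) = volume (ball (0 : EuclideanSpace ℝ (Fin n)) r) := by
    rw [volume_ball_eq hn x hr, volume_ball_eq hn 0 hr]
  have h := (lintegral_ballIndicator_le hq R r x).trans (min_le_left _ _)
  rw [hv] at h ⊢
  set v := volume (ball (0 : EuclideanSpace ℝ (Fin n)) r)
  have h1 : v⁻¹ * ∫⁻ y in ball x r, ‖ballIndicator n R y‖ₑ ^ q ≤ 1 := by
    calc _ ≤ v⁻¹ * v := by gcongr
      _ ≤ 1 := ENNReal.inv_mul_le_one _
  calc _ ≤ v ^ (1 / p) * 1 := by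
        gcongr
        exact ENNReal.rpow_le_one h1 (by positivity)
    _ = _ := mul_one _

theorem m_ballIndicator_le' (hn : 1 ≤ n) (hq : 1 ≤ q) (R : ℝ) {r : ℝ} (hr : 0 < r) :
    m (ballIndicator n R) p q r ≤ volume (ball (0 : EuclideanSpace ℝ (Fin n)) r) ^ (1 / p - 1 / q) *
      volume (ball (0 : EuclideanSpace ℝ (Fin n)) R) ^ (1 / q) := by
  refine iSup_le fun x => ?_
  have hv : volume (ball x r) = volume (ball (0 : EuclideanSpace ℝ (Fin n)) r) := by
    rw [volume_ball_eq hn x hr, volume_ball_eq hn 0 hr]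
  have h := (lintegral_ballIndicator_le hq R r x).trans (min_le_right _ _)
  have hv0 : volume (ball (0 : EuclideanSpace ℝ (Fin n)) r) ≠ 0 := (measure_ball_pos _ _ hr).ne'
  have hvt : volume (ball (0 : EuclideanSpace ℝ (Fin n)) r) ≠ ∞ := measure_ball_lt_top.ne
  rw [hv, ENNReal.mul_rpow_of_nonneg _ _ (by positivity), ← ENNReal.rpow_neg_one,
    ← ENNReal.rpow_mul, ← mul_assoc, ← ENNReal.rpow_add _ _ hv0 hvt,
    show 1 / p + -1 * (1 / q) = 1 / p - 1 / q by ring]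
  gcongr

theorem tendsto_m_ballIndicator_zero (hn : 1 ≤ n) (hq : 1 ≤ q) (hp : 0 < p) (R : ℝ) :
    Tendsto (fun r => m (ballIndicator n R) p q r) (𝓝[>] 0) (𝓝 0) := by
  have hn0 : (0 : ℝ) < n := by exact_mod_cast hn
  have h : Tendsto (fun r : ℝ => (ENNReal.ofReal r ^ (n : ℝ) *
      volume (ball (0 : EuclideanSpace ℝ (Fin n)) 1)) ^ (1 / p)) (𝓝[>] 0) (𝓝 0) := by
    have h1 : Tendsto (fun r : ℝ => ENNReal.ofReal r) (𝓝[>] 0) (𝓝 0) := by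
      simpa using (ENNReal.tendsto_ofReal tendsto_id).mono_left (nhdsWithin_le_nhds (a := (0 : ℝ)))
    have h2 := h1.ennrpow_const (n : ℝ)
    rw [ENNReal.zero_rpow_of_pos hn0] at h2
    have h3 := ENNReal.Tendsto.mul_const (b := volume (ball (0 : EuclideanSpace ℝ (Fin n)) 1)) h2
      (Or.inr measure_ball_lt_top.ne)
    rw [zero_mul] at h3
    simpa [ENNReal.zero_rpow_of_pos (inv_pos.2 hp)] using h3.ennrpow_const (1 / p)
  refine tendsto_of_tendsto_of_tendsto_of_le_of_le' tendsto_const_nhds h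
    (Eventually.of_forall fun _ => zero_le) ?_
  filter_upwards [self_mem_nhdsWithin] with r hr
  rw [← volume_ball_eq hn 0 hr]
  exact m_ballIndicator_le hn hq R hr

theorem tendsto_m_ballIndicator_atTop (hn : 1 ≤ n) (hq : 1 ≤ q) (hqp : q < p) (R : ℝ) :
    Tendsto (fun r => m (ballIndicator n R) p q r) atTop (𝓝 0) := by
  have hn0 : (0 : ℝ) < n := by exact_mod_cast hn
  have hq0 : 0 < q := by linarith
  have he : 0 < 1 / q - 1 / p := sub_pos.2 (one_div_lt_one_div_of_lt hq0 hqp)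
  have hβ0 : volume (ball (0 : EuclideanSpace ℝ (Fin n)) 1) ≠ 0 :=
    (measure_ball_pos volume _ one_pos).ne'
  have h : Tendsto (fun r : ℝ => ((ENNReal.ofReal r ^ (n : ℝ) *
      volume (ball (0 : EuclideanSpace ℝ (Fin n)) 1)) ^ (1 / q - 1 / p))⁻¹ *
      volume (ball (0 : EuclideanSpace ℝ (Fin n)) R) ^ (1 / q)) atTop (𝓝 0) := by
    have h2 := (ENNReal.tendsto_ofReal_atTop).ennrpow_const (n : ℝ)
    rw [ENNReal.top_rpow_of_pos hn0] at h2
    have h3 := ENNReal.Tendsto.mul_const (b := volume (ball (0 : EuclideanSpace ℝ (Fin n)) 1)) h2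
      (Or.inr measure_ball_lt_top.ne)
    rw [ENNReal.top_mul hβ0] at h3
    have h4 := h3.ennrpow_const (1 / q - 1 / p)
    rw [ENNReal.top_rpow_of_pos he] at h4
    have h5 := ENNReal.Tendsto.mul_const
      (b := volume (ball (0 : EuclideanSpace ℝ (Fin n)) R) ^ (1 / q)) (tendsto_inv_iff.2 h4)
      (Or.inr (ENNReal.rpow_ne_top_of_nonneg (by positivity) measure_ball_lt_top.ne))
    simpa using h5
  refine tendsto_of_tendsto_of_tendsto_of_le_of_le' tendsto_const_nhds h
    (Eventually.of_forall fun _ => zero_le) ?_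
  filter_upwards [eventually_gt_atTop 0] with r hr
  rw [← volume_ball_eq hn 0 hr, ← ENNReal.rpow_neg, neg_sub]
  exact m_ballIndicator_le' hn hq R hr

/-- A function that is dominated, up to a bounded function of bounded support, by arbitrarily small
multiples of the power `|x|^{-n/p}` has vanishing Morrey averages wherever such functions do. -/
theorem tendsto_m_of_dominated (hn : 1 ≤ n) (hq : 1 ≤ q) (hqp : q < p) {f : L0 n} {l : Filter ℝ}
    (hl : ∀ᶠ r in l, 0 < r) (hball : ∀ R, Tendsto (fun r => m (ballIndicator n R) p q r) l (𝓝 0))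
    (hf : ∀ ε : ℝ, 0 < ε → ∃ M R : ℝ,
      ∀ᵐ y, ‖f y‖ ≤ ‖((ε : ℂ) • f3 n p + (M : ℂ) • ballIndicator n R) y‖) :
    Tendsto (fun r => m f p q r) l (𝓝 0) := by
  have hC := (eNorm_f3_lt_top hn hq hqp).ne
  rw [ENNReal.tendsto_nhds_zero]
  intro η hη
  obtain ⟨ε, hε, hεη⟩ : ∃ ε : ℝ, 0 < ε ∧ ENNReal.ofReal ε * eNorm (f3 n p) p q ≤ η / 2 := by
    have h1 : Tendsto (fun ε : ℝ => ENNReal.ofReal ε * eNorm (f3 n p) p q) (𝓝[>] 0) (𝓝 0) := by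
      have h1 : Tendsto (fun r : ℝ => ENNReal.ofReal r) (𝓝[>] 0) (𝓝 0) := by
        simpa using
          (ENNReal.tendsto_ofReal tendsto_id).mono_left (nhdsWithin_le_nhds (a := (0 : ℝ)))
      simpa using ENNReal.Tendsto.mul_const h1 (Or.inr hC)
    obtain ⟨ε, h2, h3⟩ := ((h1.eventually (ge_mem_nhds (ENNReal.half_pos hη.ne'))).and
      self_mem_nhdsWithin).exists
    exact ⟨ε, h3, h2⟩
  obtain ⟨M, R, hMR⟩ := hf ε hε
  have h4 := tendsto_m_smul hq (M : ℂ) (hball R)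
  filter_upwards [hl, h4.eventually (ge_mem_nhds (ENNReal.half_pos hη.ne'))] with r hr h5
  calc m f p q r ≤ m ((ε : ℂ) • f3 n p + (M : ℂ) • ballIndicator n R) p q r := m_mono hq hMR r
    _ ≤ m ((ε : ℂ) • f3 n p) p q r + m ((M : ℂ) • ballIndicator n R) p q r := m_add_le hq _ _ r
    _ ≤ η / 2 + η / 2 := by
        refine add_le_add ?_ h5
        rw [m_smul hq]
        refine le_trans ?_ hεη
        have : ‖(ε : ℂ)‖ₑ = ENNReal.ofReal ε := by
          rw [← ofReal_norm, Complex.norm_real, Real.norm_of_nonneg hε.le]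
        rw [this]
        gcongr
        exact le_iSup₂_of_le r hr le_rfl
    _ = η := ENNReal.add_halves η

theorem tendsto_tail_f3 (hn : 1 ≤ n) (hq : 1 ≤ q) (hp : 0 < p) :
    Tendsto (fun N : ℕ => tail (f3 n p) q N) atTop (𝓝 0) := by
  have hn0 : (0 : ℝ) < n := by exact_mod_cast hn
  have hs : 0 < (n : ℝ) * q / p := by positivity
  set β := volume (ball (0 : EuclideanSpace ℝ (Fin n)) 1)
  have h1 : Tendsto (fun N : ℕ => ENNReal.ofReal ((N : ℝ) ^ (-(n * q / p))) * β) atTop (𝓝 0) := by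
    have h2 : Tendsto (fun N : ℕ => ENNReal.ofReal ((N : ℝ) ^ (-(n * q / p)))) atTop (𝓝 0) := by
      simpa using ENNReal.tendsto_ofReal
        ((tendsto_rpow_neg_atTop hs).comp tendsto_natCast_atTop_atTop)
    simpa using ENNReal.Tendsto.mul_const h2 (Or.inr (measure_ball_lt_top (x := 0)).ne)
  refine tendsto_of_tendsto_of_tendsto_of_le_of_le' tendsto_const_nhds h1
    (Eventually.of_forall fun _ => zero_le) ?_
  filter_upwards [eventually_gt_atTop 0] with N hN
  refine iSup_le fun x => ?_
  have hN' : (0 : ℝ) < N := by exact_mod_cast hN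
  calc _ ≤ ∫⁻ y in ball x 1, ENNReal.ofReal ((N : ℝ) ^ (-(n * q / p))) := by
        refine lintegral_mono_ae (ae_restrict_of_ae ?_)
        filter_upwards [coeFn_f3 n p] with y hy
        by_cases h : y ∈ ball (0 : EuclideanSpace ℝ (Fin n)) N
        · rw [indicator_of_notMem (by simpa using h)]
          exact zero_le
        · rw [indicator_of_mem (by exact h), hy, enorm_power_rpow hq]
          rw [mem_ball_zero_iff, not_lt] at h
          exact ENNReal.ofReal_le_ofReal (Real.rpow_le_rpow_of_nonpos hN' h (by linarith))
    _ = _ := by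
        rw [setLIntegral_const, volume_ball_eq hn x one_pos]
        simp [β]

theorem tail_mono (hq : 1 ≤ q) {f g : L0 n} (h : ∀ᵐ y, ‖f y‖ ≤ ‖g y‖) (N : ℕ) :
    tail f q N ≤ tail g q N := by
  refine iSup_mono fun x => lintegral_mono_ae (ae_restrict_of_ae ?_)
  filter_upwards [h] with y hy
  refine indicator_le_indicator ?_
  exact ENNReal.rpow_le_rpow (enorm_le_iff_norm_le.2 hy) (by linarith)

end Morrey

namespace ComplexInterpolation

/-! ### Bounded functions on the line that vanish at infinity -/

/-- The space of bounded Borel functions `ℝ → ℂ` (not necessarily continuous) that tend to zero at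
`±∞`. -/
def decaying : Submodule ℂ (ℝ → ℂ) where
  carrier := {φ | Measurable φ ∧ (∃ M : ℝ, ∀ v, ‖φ v‖ ≤ M) ∧ Tendsto φ (cocompact ℝ) (𝓝 0)}
  zero_mem' := ⟨measurable_zero, ⟨0, by simp⟩, tendsto_const_nhds⟩
  add_mem' := by
    rintro φ ψ ⟨h1, ⟨M, h2⟩, h3⟩ ⟨h1', ⟨M', h2'⟩, h3'⟩
    exact ⟨h1.add h1', ⟨M + M', fun v => (norm_add_le _ _).trans (add_le_add (h2 v) (h2' v))⟩,
      by have h := h3.add h3'; rwa [add_zero] at h⟩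
  smul_mem' := by
    rintro c φ ⟨h1, ⟨M, h2⟩, h3⟩
    refine ⟨h1.const_smul c, ⟨‖c‖ * M, fun v => ?_⟩,
      by have h := h3.const_smul c; rwa [smul_zero] at h⟩
    rw [Pi.smul_apply, norm_smul]
    gcongr
    exact h2 v

theorem mem_decaying {φ : ℝ → ℂ} {M K : ℝ} (hm : Measurable φ) (hM : ∀ v, ‖φ v‖ ≤ M)
    (hK : ∀ v, ‖φ v‖ ≤ K * |v|⁻¹) : φ ∈ decaying := by
  refine ⟨hm, ⟨M, hM⟩, squeeze_zero_norm hK ?_⟩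
  have h : Tendsto (fun t : ℝ => |t|⁻¹) (cocompact ℝ) (𝓝 0) :=
    tendsto_inv_atTop_zero.comp (tendsto_norm_cocompact_atTop (E := ℝ))
  simpa using h.const_mul K

theorem exists_norm_le_of_mem_decaying {φ : ℝ → ℂ} (hφ : φ ∈ decaying) {ε : ℝ} (hε : 0 < ε) :
    ∃ K : ℝ, ∀ v, K < |v| → ‖φ v‖ ≤ ε := by
  have h := hφ.2.2.norm
  rw [norm_zero] at h
  have h1 := h.eventually (ge_mem_nhds hε)
  rw [← Metric.cobounded_eq_cocompact, (hasBasis_cobounded_norm (E := ℝ)).eventually_iff] at h1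
  obtain ⟨K, -, hK⟩ := h1
  exact ⟨K, fun v hv => hK hv.le⟩

/-! ### The exponential kernels -/

theorem norm_cexp_mul_sub_le {v c : ℝ} {z w : ℂ} (hz : z.re * v ≤ c) (hw : w.re * v ≤ c) :
    ‖Complex.exp (z * v) - Complex.exp (w * v)‖ ≤ |v| * Real.exp c * ‖z - w‖ := by
  have hconv : Convex ℝ {z : ℂ | z.re * v ≤ c} :=
    convex_halfSpace_le (f := fun z : ℂ => z.re * v)
      ⟨fun x y => by simp [add_mul], fun a x => by simp [mul_assoc]⟩ c
  refine hconv.norm_image_sub_le_of_norm_hasDerivWithin_le (f := fun z : ℂ => Complex.exp (z * v))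
    (f' := fun z => Complex.exp (z * v) * v) (fun x _ => ?_) (fun x hx => ?_) hw hz
  · have h := ((hasDerivAt_id x).mul_const (v : ℂ)).cexp
    simpa using h.hasDerivWithinAt
  · rw [norm_mul, Complex.norm_exp, Complex.norm_real, Real.norm_eq_abs, mul_comm]
    gcongr
    simpa using hx

/-- The primitive `∫₁^z e^{wv} dw` of the exponential, restricted to `v < 0`. -/
noncomputable def kernel (z : ℂ) (v : ℝ) : ℂ :=
  if v < 0 then (Complex.exp (z * v) - Complex.exp v) / v else 0

/-- The exponential `e^{zv}`, restricted to `v < 0`. -/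
noncomputable def kernelDeriv (z : ℂ) (v : ℝ) : ℂ := if v < 0 then Complex.exp (z * v) else 0

/-- The primitive `∫ e^{wv} dw` on the imaginary axis, at `w = it`, with base point `1` for `v < 0`
and base point `0` for `v > 0`. -/
noncomputable def boundaryKernel (t v : ℝ) : ℂ :=
  (Complex.exp (t * Complex.I * v) - Complex.exp (min v 0 : ℝ)) / v

theorem norm_kernel_sub_le {z w : ℂ} (hz : 0 ≤ z.re) (hw : 0 ≤ w.re) (v : ℝ) :
    ‖kernel z v - kernel w v‖ ≤ ‖z - w‖ := by
  unfold kernel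
  split_ifs with hv
  · rw [← sub_div, sub_sub_sub_cancel_right, norm_div, Complex.norm_real, Real.norm_eq_abs,
      div_le_iff₀ (abs_pos.2 hv.ne), mul_comm ‖z - w‖]
    simpa using norm_cexp_mul_sub_le (c := 0) (mul_nonpos_of_nonneg_of_nonpos hz hv.le)
      (mul_nonpos_of_nonneg_of_nonpos hw hv.le)
  · simp

theorem kernel_one (v : ℝ) : kernel 1 v = 0 := by simp [kernel]

theorem norm_kernel_le {z : ℂ} (hz : 0 ≤ z.re) (v : ℝ) : ‖kernel z v‖ ≤ ‖z - 1‖ := by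
  simpa [kernel_one] using norm_kernel_sub_le hz (w := 1) (by simp) v

theorem norm_kernel_sub_sub_le {z w : ℂ} {r : ℝ} (hr : 0 < r) (hz : r ≤ z.re) (hw : r ≤ w.re)
    (v : ℝ) : ‖kernel z v - kernel w v - (z - w) * kernelDeriv w v‖ ≤ r⁻¹ * ‖z - w‖ ^ 2 := by
  unfold kernel kernelDeriv
  split_ifs with hv
  · have hv0 : (v : ℂ) ≠ 0 := by exact_mod_cast hv.ne
    have hexp : |v| * Real.exp (r * v) ≤ r⁻¹ := by
      rw [abs_of_neg hv, le_inv_comm₀ (mul_pos (neg_pos.2 hv) (Real.exp_pos _)) hr, mul_inv,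
        ← Real.exp_neg, ← div_eq_inv_mul, le_div_iff₀ (by linarith)]
      have := Real.add_one_le_exp (-(r * v))
      linarith
    -- The mean value inequality for the Taylor remainder, on the segment from `w` to `z`.
    set g : ℂ → ℂ := fun ζ => Complex.exp (ζ * v) - ζ * (v * Complex.exp (w * v))
    have hg : ∀ x, HasDerivAt g (v * (Complex.exp (x * v) - Complex.exp (w * v))) x := by
      intro x
      have h1 := (((hasDerivAt_id x).mul_const (v : ℂ)).cexp).sub
        ((hasDerivAt_id x).mul_const ((v : ℂ) * Complex.exp (w * v)))
      refine h1.congr_deriv ?_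
      rw [id_eq]
      ring
    have hseg : ∀ x ∈ segment ℝ w z, r ≤ x.re ∧ ‖x - w‖ ≤ ‖z - w‖ := by
      intro x hx
      refine ⟨?_, norm_sub_le_of_mem_segment hx⟩
      exact (convex_halfSpace_re_ge r).segment_subset hw hz hx
    have hmv := (convex_segment w z).norm_image_sub_le_of_norm_hasDerivWithin_le (f := g)
      (C := |v| * (r⁻¹ * ‖z - w‖)) (fun x _ => (hg x).hasDerivWithinAt) (fun x hx => ?_)
      (left_mem_segment ℝ w z) (right_mem_segment ℝ w z)
    · have h2 : (Complex.exp (z * v) - Complex.exp v) / v - (Complex.exp (w * v) - Complex.exp v) / v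
          - (z - w) * Complex.exp (w * v) = (g z - g w) / v := by
        simp only [g]
        field_simp
        ring
      rw [h2, norm_div, Complex.norm_real, Real.norm_eq_abs, div_le_iff₀ (abs_pos.2 hv.ne)]
      calc _ ≤ _ := hmv
        _ = _ := by ring
    · rw [norm_mul, Complex.norm_real, Real.norm_eq_abs]
      gcongr
      have h3 := norm_cexp_mul_sub_le (c := r * v) (mul_le_mul_of_nonpos_right (hseg x hx).1 hv.le)
        (mul_le_mul_of_nonpos_right hw hv.le)
      refine h3.trans ?_
      gcongr
      exact (hseg x hx).2
  · simp only [sub_self, mul_zero, norm_zero]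
    positivity

theorem kernel_mem {z : ℂ} (hz : 0 ≤ z.re) : kernel z ∈ decaying := by
  refine mem_decaying (K := 2) ?_ (norm_kernel_le hz) fun v => ?_
  · refine Measurable.ite measurableSet_Iio ?_ measurable_const
    fun_prop
  · unfold kernel
    split_ifs with hv
    · rw [norm_div, Complex.norm_real, Real.norm_eq_abs, div_eq_mul_inv]
      gcongr
      refine (norm_sub_le _ _).trans ?_
      have h1 : ‖Complex.exp (z * v)‖ ≤ 1 := by
        rw [Complex.norm_exp, Real.exp_le_one_iff]
        simpa using mul_nonpos_of_nonneg_of_nonpos hz hv.le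
      have h2 : ‖Complex.exp v‖ ≤ 1 := by
        rw [Complex.norm_exp, Real.exp_le_one_iff]
        simpa using hv.le
      linarith
    · simp only [norm_zero]; positivity

theorem kernelDeriv_mem {z : ℂ} (hz : 0 < z.re) : kernelDeriv z ∈ decaying := by
  refine mem_decaying (M := 1) (K := z.re⁻¹) ?_ (fun v => ?_) fun v => ?_
  · refine Measurable.ite measurableSet_Iio ?_ measurable_const
    fun_prop
  · unfold kernelDeriv
    split_ifs with hv
    · rw [Complex.norm_exp, Real.exp_le_one_iff]
      simpa using mul_nonpos_of_nonneg_of_nonpos hz.le hv.le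
    · simp
  · unfold kernelDeriv
    split_ifs with hv
    · rw [Complex.norm_exp, abs_of_neg hv, ← mul_inv]
      have h1 : (z * v).re = -(z.re * -v) := by simp
      rw [h1, Real.exp_neg]
      have h2 : 0 < z.re * -v := mul_pos hz (by linarith)
      refine inv_anti₀ h2 ?_
      linarith [Real.add_one_le_exp (z.re * -v)]
    · simp only [norm_zero]; positivity

theorem norm_boundaryKernel_sub_le (t s v : ℝ) :
    ‖boundaryKernel t v - boundaryKernel s v‖ ≤ |t - s| := by
  rcases eq_or_ne v 0 with rfl | hv
  · simp [boundaryKernel]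
  unfold boundaryKernel
  rw [← sub_div, sub_sub_sub_cancel_right, norm_div, Complex.norm_real, Real.norm_eq_abs,
    div_le_iff₀ (abs_pos.2 hv), mul_comm |t - s|]
  have := norm_cexp_mul_sub_le (v := v) (c := 0) (z := t * Complex.I) (w := s * Complex.I)
    (by simp) (by simp)
  rw [← sub_mul, norm_mul, Complex.norm_I, mul_one, Real.exp_zero, mul_one, ← Complex.ofReal_sub,
    Complex.norm_real, Real.norm_eq_abs] at this
  exact this

theorem boundaryKernel_mem (t : ℝ) : boundaryKernel t ∈ decaying := by
  refine mem_decaying (M := 1 + |t|) (K := 2) ?_ (fun v => ?_) fun v => ?_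
  · unfold boundaryKernel
    fun_prop
  · have h0 : ‖boundaryKernel 0 v‖ ≤ 1 := by
      unfold boundaryKernel
      rcases le_or_gt v 0 with hv | hv
      · rcases hv.eq_or_lt with rfl | hv
        · simp
        · have := norm_cexp_mul_sub_le (v := v) (c := 0) (z := 0) (w := 1) (by simp)
            (by simpa using hv.le)
          rw [norm_div, Complex.norm_real, Real.norm_eq_abs, div_le_iff₀ (abs_pos.2 hv.ne)]
          simpa [min_eq_left hv.le] using this
      · simp [min_eq_right hv.le]
    calc ‖boundaryKernel t v‖ = ‖boundaryKernel 0 v + (boundaryKernel t v - boundaryKernel 0 v)‖ := by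
          congr 1; ring
      _ ≤ 1 + |t - 0| := (norm_add_le _ _).trans (add_le_add h0 (norm_boundaryKernel_sub_le t 0 v))
      _ = 1 + |t| := by rw [sub_zero]
  · unfold boundaryKernel
    rw [norm_div, Complex.norm_real, Real.norm_eq_abs, div_eq_mul_inv]
    gcongr
    refine (norm_sub_le _ _).trans ?_
    have h1 : ‖Complex.exp (t * Complex.I * v)‖ ≤ 1 := by
      rw [Complex.norm_exp]; simp
    have h2 : ‖Complex.exp (min v 0 : ℝ)‖ ≤ 1 := by
      rw [Complex.norm_exp, Real.exp_le_one_iff, Complex.ofReal_re]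
      exact min_le_right _ _
    linarith

/-! ### A criterion for the second interpolation space -/

section Criterion

theorem hasDerivAt_clm_comp {E F : Type*} [SeminormedAddCommGroup E] [NormedSpace ℂ E]
    [SeminormedAddCommGroup F] [NormedSpace ℂ F] (ℓ : E →L[ℂ] F) {f : ℂ → E} {f' : E} {z : ℂ}
    (hf : HasDerivAt f f' z) : HasDerivAt (fun w => ℓ (f w)) (ℓ f') z := by
  rw [hasDerivAt_iff_hasFDerivAt, ← hasFDerivWithinAt_univ] at hf ⊢
  have h := hasFDerivWithinAt_clm_comp ℓ hf
  rwa [show ℓ ∘L ContinuousLinearMap.toSpanSingleton ℂ f' =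
    ContinuousLinearMap.toSpanSingleton ℂ (ℓ f') by ext; simp] at h

variable {X₀ X₁ Z : Type*} [NormedAddCommGroup X₀] [NormedSpace ℂ X₀]
  [NormedAddCommGroup X₁] [NormedSpace ℂ X₁] [AddCommGroup Z] [Module ℂ Z]

/-- The element of `decaying` given by `kernel z`, for `Re z ≥ 0` (and zero elsewhere). -/
noncomputable def kernelElt (z : ℂ) : decaying :=
  open Classical in if hz : 0 ≤ z.re then ⟨kernel z, kernel_mem hz⟩ else 0

theorem coe_kernelElt {z : ℂ} (hz : 0 ≤ z.re) : (kernelElt z : ℝ → ℂ) = kernel z := by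
  rw [kernelElt, dif_pos hz]

variable {T : decaying →ₗ[ℂ] X₀} {C : NNReal}

theorem norm_map_kernelElt_le (hT : ∀ (φ : decaying) (M : ℝ), (∀ v, ‖φ.1 v‖ ≤ M) → ‖T φ‖ ≤ C * M)
    {z : ℂ} (hz : 0 ≤ z.re) : ‖T (kernelElt z)‖ ≤ C * ‖z - 1‖ :=
  hT _ _ fun v => by rw [coe_kernelElt hz]; exact norm_kernel_le hz v

theorem continuousOn_map_kernelElt
    (hT : ∀ (φ : decaying) (M : ℝ), (∀ v, ‖φ.1 v‖ ≤ M) → ‖T φ‖ ≤ C * M) :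
    ContinuousOn (fun z => T (kernelElt z)) {z | 0 ≤ z.re} := by
  refine LipschitzOnWith.continuousOn (K := C) (LipschitzOnWith.of_dist_le_mul fun z hz w hw => ?_)
  rw [dist_eq_norm, dist_eq_norm, ← map_sub]
  refine hT _ _ fun v => ?_
  rw [Submodule.coe_sub, coe_kernelElt hz, coe_kernelElt hw]
  exact norm_kernel_sub_le hz hw v

theorem hasDerivAt_map_kernelElt
    (hT : ∀ (φ : decaying) (M : ℝ), (∀ v, ‖φ.1 v‖ ≤ M) → ‖T φ‖ ≤ C * M) {w : ℂ} (hw : 0 < w.re) :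
    HasDerivAt (fun z => T (kernelElt z)) (T ⟨kernelDeriv w, kernelDeriv_mem hw⟩) w := by
  rw [hasDerivAt_iff_isLittleO]
  refine Asymptotics.IsBigO.trans_isLittleO (g := fun z => ‖z - w‖ ^ 2) ?_
    (Asymptotics.isLittleO_pow_sub_sub w one_lt_two)
  refine Asymptotics.IsBigO.of_bound (C * (w.re / 2)⁻¹) ?_
  have hopen : IsOpen {z : ℂ | w.re / 2 < z.re} := isOpen_lt continuous_const Complex.continuous_re
  filter_upwards [hopen.mem_nhds (show w.re / 2 < w.re by linarith)] with z hz
  have hz : w.re / 2 < z.re := hz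
  rw [← map_smul, ← map_sub, ← map_sub, Real.norm_of_nonneg (by positivity), mul_assoc]
  refine hT _ _ fun v => ?_
  simp only [Submodule.coe_sub, Submodule.coe_smul, Pi.sub_apply, Pi.smul_apply, smul_eq_mul]
  rw [coe_kernelElt (by linarith), coe_kernelElt hw.le]
  exact norm_kernel_sub_sub_le (by linarith) hz.le (by linarith) v

theorem lipschitzWith_map_boundaryKernel
    (hT : ∀ (φ : decaying) (M : ℝ), (∀ v, ‖φ.1 v‖ ≤ M) → ‖T φ‖ ≤ C * M) :
    LipschitzWith C fun t => T ⟨boundaryKernel t, boundaryKernel_mem t⟩ := by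
  refine LipschitzWith.of_dist_le_mul fun t s => ?_
  rw [dist_eq_norm, Real.dist_eq, ← map_sub]
  exact hT _ _ fun v => norm_boundaryKernel_sub_le t s v

/-- Off `v = 0`, the kernel with base point `1` differs from the boundary kernel by the part that
the other end of the strip takes over. -/
theorem kernel_sub_boundaryKernel (t : ℝ) {v : ℝ} (hv : v ≠ 0) :
    kernel (1 - t * Complex.I) (-v) * Complex.exp v =
      kernel (t * Complex.I) v - boundaryKernel t v := by
  unfold kernel boundaryKernel
  rcases lt_or_gt_of_ne hv with h | h
  · rw [if_neg (by linarith), if_pos h, min_eq_left h.le]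
    ring
  · have hv0 : (v : ℂ) ≠ 0 := by exact_mod_cast hv
    rw [if_pos (by linarith), if_neg (by linarith), min_eq_right h.le, div_mul_eq_mul_div, sub_mul,
      ← Complex.exp_add, ← Complex.exp_add]
    have h1 : (1 - t * Complex.I) * ((-v : ℝ) : ℂ) + v = t * Complex.I * v := by push_cast; ring
    have h2 : ((-v : ℝ) : ℂ) + v = 0 := by push_cast; ring
    rw [h1, h2, Complex.ofReal_neg, div_neg, Complex.ofReal_zero]
    ring

/-- The map `X₀ × X₁ → X₀ + X₁`. -/
noncomputable def SumSpace.ofProd (ι₀ : X₀ →ₗ[ℂ] Z) (ι₁ : X₁ →ₗ[ℂ] Z) :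
    X₀ × X₁ →L[ℂ] SumSpace ι₀ ι₁ :=
  (sumKer ι₀ ι₁).mkQL ∘L (WithLp.prodContinuousLinearEquiv 1 ℂ X₀ X₁).symm.toContinuousLinearMap

variable {ι₀ : X₀ →ₗ[ℂ] Z} {ι₁ : X₁ →ₗ[ℂ] Z}

theorem SumSpace.toAmbient_ofProd (x : X₀ × X₁) :
    SumSpace.toAmbient ι₀ ι₁ (SumSpace.ofProd ι₀ ι₁ x) = ι₀ x.1 + ι₁ x.2 := rfl

theorem SumSpace.ofProd_eq {x y : X₀ × X₁} (h : ι₀ x.1 + ι₁ x.2 = ι₀ y.1 + ι₁ y.2) :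
    SumSpace.ofProd ι₀ ι₁ x = SumSpace.ofProd ι₀ ι₁ y := by
  refine (Submodule.Quotient.eq _).2 ?_
  change ι₀ (x.1 - y.1) + ι₁ (x.2 - y.2) = 0
  rw [map_sub, map_sub, sub_add_sub_comm, h, sub_self]

/-- If functions on the line embed in `X₀` and `X₁` so that the two embeddings differ by the
reflection `v ↦ -v` and the factor `e^v`, then the image of `e^{θv}` lies in `[X₀, X₁]^θ`.

The function `∫ e^{zv} dz` is used, with base point `1` for `v < 0` and base point `0` for `v > 0`:
this choice is what makes its boundary values lie in `X₀` and `X₁` separately. -/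
theorem mem_secondSpace_of_embedding {T₀ : decaying →ₗ[ℂ] X₀} {T₁ : decaying →ₗ[ℂ] X₁}
    {C₀ C₁ : NNReal} (hT₀ : ∀ (φ : decaying) (M : ℝ), (∀ v, ‖φ.1 v‖ ≤ M) → ‖T₀ φ‖ ≤ C₀ * M)
    (hT₁ : ∀ (φ : decaying) (M : ℝ), (∀ v, ‖φ.1 v‖ ≤ M) → ‖T₁ φ‖ ≤ C₁ * M)
    (h₀₁ : ∀ φ₀ φ₁ : decaying, (∀ v, v ≠ 0 → φ₁.1 (-v) * Complex.exp v = φ₀.1 v) →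
      ι₁ (T₁ φ₁) = ι₀ (T₀ φ₀))
    {θ : ℝ} (hθ : 0 < θ) (hθ' : θ < 1) {f : Z}
    (hf : ∀ φ₀ φ₁ : decaying,
      (∀ v : ℝ, v ≠ 0 → φ₀.1 v + φ₁.1 (-v) * Complex.exp v = Complex.exp (θ * v)) →
      ι₀ (T₀ φ₀) + ι₁ (T₁ φ₁) = f) :
    f ∈ secondSpace ι₀ ι₁ θ := by
  set G : ℂ → SumSpace ι₀ ι₁ := fun z =>
    SumSpace.ofProd ι₀ ι₁ (T₀ (kernelElt z), -T₁ (kernelElt (1 - z))) with hG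
  have hder : ∀ w : ℂ, ∀ hw : 0 < w.re, ∀ hw' : 0 < (1 - w).re, HasDerivAt G
      (SumSpace.ofProd ι₀ ι₁ (T₀ ⟨kernelDeriv w, kernelDeriv_mem hw⟩,
        T₁ ⟨kernelDeriv (1 - w), kernelDeriv_mem hw'⟩)) w := by
    intro w hw hw'
    have h1 := hasDerivAt_map_kernelElt hT₀ hw
    have h2 := ((hasDerivAt_map_kernelElt hT₁ hw').comp_const_sub 1 w).neg
    rw [neg_neg] at h2
    exact hasDerivAt_clm_comp (SumSpace.ofProd ι₀ ι₁) (h1.prodMk h2)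
  refine ⟨G, ⟨?_, ?_, ?_, ?_, ?_⟩, _, hder θ (by simpa using hθ) (by simpa using hθ'), ?_⟩
  · refine (SumSpace.ofProd ι₀ ι₁).continuous.comp_continuousOn (ContinuousOn.prodMk ?_ ?_)
    · exact (continuousOn_map_kernelElt hT₀).mono fun z hz => hz.1
    · refine ContinuousOn.neg ((continuousOn_map_kernelElt hT₁).comp (by fun_prop) fun z hz => ?_)
      simpa using hz.2
  · refine ⟨‖SumSpace.ofProd ι₀ ι₁‖ * (C₀ + C₁), fun z hz => ?_⟩
    refine ((SumSpace.ofProd ι₀ ι₁).le_opNorm _).trans ?_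
    rw [mul_assoc]
    gcongr
    have h1 := norm_map_kernelElt_le hT₀ hz.1
    have h2 := norm_map_kernelElt_le hT₁ (z := 1 - z) (by simpa using hz.2)
    have h3 : ‖z - 1‖ ≤ 1 + ‖z‖ := by
      have := norm_sub_le z 1
      rw [norm_one] at this
      linarith
    have h4 : ‖(1 - z) - 1‖ ≤ 1 + ‖z‖ := by
      rw [show (1 - z) - 1 = -z by ring, norm_neg]
      linarith
    rw [Prod.norm_def, norm_neg, add_mul]
    refine max_le (h1.trans ?_) (h2.trans ?_)
    · have : (0 : ℝ) ≤ C₁ * (1 + ‖z‖) := by positivity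
      nlinarith [mul_le_mul_of_nonneg_left h3 C₀.coe_nonneg]
    · have : (0 : ℝ) ≤ C₀ * (1 + ‖z‖) := by positivity
      nlinarith [mul_le_mul_of_nonneg_left h4 C₁.coe_nonneg]
  · intro z hz
    exact (hasDerivAt_iff_hasFDerivAt.1
      (hder z hz.1 (by simpa using hz.2))).differentiableAt.differentiableWithinAt
  · refine ⟨_, ⟨C₀, lipschitzWith_map_boundaryKernel hT₀⟩, fun t => SumSpace.ofProd_eq ?_⟩
    have h := h₀₁ (kernelElt (t * Complex.I) - ⟨boundaryKernel t, boundaryKernel_mem t⟩)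
      (kernelElt (1 - t * Complex.I)) fun v hv => by
        rw [Submodule.coe_sub, coe_kernelElt (by simp), coe_kernelElt (by simp)]
        exact kernel_sub_boundaryKernel t hv
    simp only [map_neg, map_zero, add_zero, h, map_sub]
    abel
  · refine ⟨fun t => -T₁ ⟨boundaryKernel (-t), boundaryKernel_mem (-t)⟩,
      ⟨C₁, ?_⟩, fun t => SumSpace.ofProd_eq ?_⟩
    · refine LipschitzWith.of_dist_le_mul fun t s => ?_
      have := (lipschitzWith_map_boundaryKernel hT₁).dist_le_mul (-t) (-s)
      rwa [dist_neg_neg] at this ⊢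
    · have h := h₀₁ (kernelElt (1 + t * Complex.I))
        (kernelElt (-(t * Complex.I)) - ⟨boundaryKernel (-t), boundaryKernel_mem (-t)⟩)
        fun v hv => by
          have h5 := kernel_sub_boundaryKernel (-t) (neg_ne_zero.2 hv)
          rw [Submodule.coe_sub, coe_kernelElt (by simp), coe_kernelElt (by simp), Pi.sub_apply]
          have h6 : (((-t : ℝ) : ℂ) * Complex.I) = -(t * Complex.I) := by push_cast; ring
          rw [h6, sub_neg_eq_add, neg_neg] at h5
          change (kernel (-(t * Complex.I)) (-v) - boundaryKernel (-t) (-v)) * _ = _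
          rw [← h5, mul_assoc, ← Complex.exp_add]
          simp
      simp only [map_neg, map_zero, zero_add, ← h, map_sub]
      rw [show (1 : ℂ) - (1 + t * Complex.I) = -(t * Complex.I) by ring]
      abel
  · refine hf _ _ fun v hv => ?_
    change kernelDeriv θ v + kernelDeriv (1 - θ) (-v) * _ = _
    unfold kernelDeriv
    rcases lt_or_gt_of_ne hv with h | h
    · rw [if_pos h, if_neg (by linarith)]
      ring
    · rw [if_neg (by linarith), if_pos (by linarith), zero_add, ← Complex.exp_add]
      congr 1
      push_cast
      ring

end Criterion

end ComplexInterpolation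

namespace Morrey

open ComplexInterpolation

variable {n : ℕ} {p q : ℝ}

/-! ### Power functions modulated by functions of `log |x|` -/

/-- The function `x ↦ φ (δ log |x|) |x|^{-n/p}`. -/
noncomputable def modulatedPower (n : ℕ) (p δ : ℝ) : decaying →ₗ[ℂ] L0 n where
  toFun φ := AEEqFun.mk
    (fun x => φ.1 (δ * Real.log ‖x‖) * ((‖x‖ ^ (-(n : ℝ) / p) : ℝ) : ℂ))
    ((φ.2.1.comp (by fun_prop)).mul
      (Complex.measurable_ofReal.comp (measurable_norm.pow_const _))).aestronglyMeasurable
  map_add' φ ψ := by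
    rw [AEEqFun.mk_add_mk]
    congr 1
    ext x
    simp [add_mul]
  map_smul' c φ := by
    rw [RingHom.id_apply, AEEqFun.smul_mk]
    congr 1
    ext x
    simp [mul_assoc]

theorem coeFn_modulatedPower (n : ℕ) (p δ : ℝ) (φ : decaying) :
    modulatedPower n p δ φ =ᵐ[volume]
      fun x => φ.1 (δ * Real.log ‖x‖) * ((‖x‖ ^ (-(n : ℝ) / p) : ℝ) : ℂ) :=
  AEEqFun.coeFn_mk _ _

theorem norm_modulatedPower_le (n : ℕ) (p δ : ℝ) {φ : decaying} {M : ℝ} (hM : ∀ v, ‖φ.1 v‖ ≤ M) :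
    ∀ᵐ y, ‖modulatedPower n p δ φ y‖ ≤ ‖((M : ℂ) • f3 n p) y‖ := by
  have hM0 : 0 ≤ M := (norm_nonneg _).trans (hM 0)
  filter_upwards [coeFn_modulatedPower n p δ φ, coeFn_f3 n p, AEEqFun.coeFn_smul (M : ℂ) (f3 n p)]
    with y h1 h2 h3
  rw [h1, h3, Pi.smul_apply, h2, smul_eq_mul, norm_mul, norm_mul, Complex.norm_real M,
    Real.norm_of_nonneg hM0]
  gcongr
  exact hM _

theorem eNorm_modulatedPower_le (hq : 1 ≤ q) (δ : ℝ) {φ : decaying} {M : ℝ}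
    (hM : ∀ v, ‖φ.1 v‖ ≤ M) :
    eNorm (modulatedPower n p δ φ) p q ≤ ENNReal.ofReal M * eNorm (f3 n p) p q := by
  have hM0 : 0 ≤ M := (norm_nonneg _).trans (hM 0)
  refine (eNorm_mono hq (norm_modulatedPower_le n p δ hM)).trans (le_of_eq ?_)
  rw [eNorm_smul hq, ← ofReal_norm, Complex.norm_real, Real.norm_of_nonneg hM0]

theorem modulatedPower_mem_space (hn : 1 ≤ n) [hq : Fact (1 ≤ q)] (hqp : q < p) (δ : ℝ)
    (φ : decaying) : modulatedPower n p δ φ ∈ space n p q := by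
  obtain ⟨M, hM⟩ := φ.2.2.1
  exact (eNorm_modulatedPower_le hq.out δ hM).trans_lt
    (ENNReal.mul_lt_top ENNReal.ofReal_lt_top (eNorm_f3_lt_top hn hq.out hqp))

/-- For `φ` small outside a bounded set, `φ (δ log |x|) |x|^{-n/p}` is small relative to
`|x|^{-n/p}` outside an annulus, on which it is bounded. -/
theorem exists_norm_modulatedPower_le {δ : ℝ} (hp : 0 < p) (hδ : δ ≠ 0)
    (φ : decaying) {ε : ℝ} (hε : 0 < ε) : ∃ M R : ℝ, ∀ᵐ y, ‖modulatedPower n p δ φ y‖ ≤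
      ‖((ε : ℂ) • f3 n p + (M : ℂ) • ballIndicator n R) y‖ := by
  obtain ⟨B, hB⟩ := φ.2.2.1
  have hB0 : 0 ≤ B := (norm_nonneg _).trans (hB 0)
  obtain ⟨K, hK⟩ := exists_norm_le_of_mem_decaying φ.2 hε
  set R := Real.exp ((|K| + 1) / |δ|) with hR
  have hδ' : 0 < |δ| := abs_pos.2 hδ
  refine ⟨B * R⁻¹ ^ (-(n : ℝ) / p), R, ?_⟩
  have hM0 : 0 ≤ B * R⁻¹ ^ (-(n : ℝ) / p) := by positivity
  filter_upwards [coeFn_modulatedPower n p δ φ, coeFn_f3 n p, AEEqFun.coeFn_smul (ε : ℂ) (f3 n p),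
    AEEqFun.coeFn_smul ((B * R⁻¹ ^ (-(n : ℝ) / p) : ℝ) : ℂ) (ballIndicator n R),
    coeFn_ballIndicator n R, AEEqFun.coeFn_add ((ε : ℂ) • f3 n p)
      (((B * R⁻¹ ^ (-(n : ℝ) / p) : ℝ) : ℂ) • ballIndicator n R)] with y h1 h2 h3 h4 h5 h6
  set w := ‖y‖ ^ (-(n : ℝ) / p) with hw
  have hw0 : 0 ≤ w := Real.rpow_nonneg (norm_nonneg _) _
  rw [h6, Pi.add_apply, h3, h4, Pi.smul_apply, Pi.smul_apply, h2, h5, h1, norm_mul,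
    Complex.norm_real, Real.norm_of_nonneg hw0, smul_eq_mul, smul_eq_mul]
  have hlow : ε * w ≤ ‖(ε : ℂ) * w + ((B * R⁻¹ ^ (-(n : ℝ) / p) : ℝ) : ℂ) *
      (ball (0 : EuclideanSpace ℝ (Fin n)) R).indicator (fun _ => (1 : ℂ)) y‖ ∧
      (y ∈ ball (0 : EuclideanSpace ℝ (Fin n)) R → B * R⁻¹ ^ (-(n : ℝ) / p) ≤
      ‖(ε : ℂ) * w + ((B * R⁻¹ ^ (-(n : ℝ) / p) : ℝ) : ℂ) *
      (ball (0 : EuclideanSpace ℝ (Fin n)) R).indicator (fun _ => (1 : ℂ)) y‖) := by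
    have hεw : 0 ≤ ε * w := by positivity
    by_cases hy : y ∈ ball (0 : EuclideanSpace ℝ (Fin n)) R
    · rw [indicator_of_mem hy, mul_one, ← Complex.ofReal_mul, ← Complex.ofReal_add,
        Complex.norm_real, Real.norm_of_nonneg (add_nonneg hεw hM0)]
      exact ⟨by linarith, fun _ => by linarith⟩
    · rw [indicator_of_notMem hy, mul_zero, add_zero, ← Complex.ofReal_mul,
        Complex.norm_real, Real.norm_of_nonneg hεw]
      exact ⟨le_rfl, fun h => absurd h hy⟩
  by_cases hy : K < |δ * Real.log ‖y‖|
  · refine le_trans ?_ hlow.1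
    gcongr
    exact hK _ hy
  · have hlog : |Real.log ‖y‖| < (|K| + 1) / |δ| := by
      rw [lt_div_iff₀ hδ', mul_comm, ← abs_mul]
      linarith [le_abs_self K]
    rw [abs_lt] at hlog
    rcases eq_or_ne y 0 with rfl | hy0
    · have h0 : (0 : EuclideanSpace ℝ (Fin n)) ∈ ball (0 : EuclideanSpace ℝ (Fin n)) R :=
        mem_ball_self (Real.exp_pos _)
      refine le_trans ?_ (hlow.2 h0)
      refine mul_le_mul (hB _) ?_ hw0 hB0
      rw [hw, norm_zero]
      rcases Nat.eq_zero_or_pos n with hn | hn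
      · simp [hn]
      · have hne : -(n : ℝ) / p ≠ 0 :=
          div_ne_zero (neg_ne_zero.2 (by exact_mod_cast hn.ne')) hp.ne'
        rw [Real.zero_rpow hne]
        positivity
    · have hy' : 0 < ‖y‖ := norm_pos_iff.2 hy0
      refine le_trans ?_ (hlow.2 ?_)
      · refine mul_le_mul (hB _) ?_ hw0 hB0
        refine Real.rpow_le_rpow_of_nonpos (by positivity) ?_ ?_
        · rw [hR, ← Real.exp_neg]
          exact ((Real.lt_log_iff_exp_lt hy').1 hlog.1).le
        · exact div_nonpos_of_nonpos_of_nonneg (neg_nonpos.2 (Nat.cast_nonneg n)) hp.le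
      · rw [mem_ball_zero_iff]
        exact (Real.log_lt_iff_lt_exp hy').1 hlog.2

/-- The map `modulatedPower`, with values in the Morrey space. -/
noncomputable def modulatedPowerMorrey (hn : 1 ≤ n) [Fact (1 ≤ q)] (hqp : q < p) (δ : ℝ) :
    decaying →ₗ[ℂ] space n p q :=
  (modulatedPower n p δ).codRestrict _ (modulatedPower_mem_space hn hqp δ)

theorem modulatedPower_mem_V0 (hn : 1 ≤ n) [hq : Fact (1 ≤ q)] (hqp : q < p) {δ : ℝ}
    (hδ : δ ≠ 0) (φ : decaying) :
    modulatedPowerMorrey hn hqp δ φ ∈ V0 n p q := by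
  have hp : 0 < p := by linarith [hq.out]
  exact tendsto_m_of_dominated hn hq.out hqp self_mem_nhdsWithin
    (tendsto_m_ballIndicator_zero hn hq.out hp)
    fun ε hε => exists_norm_modulatedPower_le hp hδ φ hε

theorem modulatedPower_mem_VInfty (hn : 1 ≤ n) [hq : Fact (1 ≤ q)] (hqp : q < p) {δ : ℝ}
    (hδ : δ ≠ 0) (φ : decaying) :
    modulatedPowerMorrey hn hqp δ φ ∈ VInfty n p q := by
  have hp : 0 < p := by linarith [hq.out]
  exact tendsto_m_of_dominated hn hq.out hqp (eventually_gt_atTop 0)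
    (tendsto_m_ballIndicator_atTop hn hq.out hqp)
    fun ε hε => exists_norm_modulatedPower_le hp hδ φ hε

theorem modulatedPower_mem_VStar (hn : 1 ≤ n) [hq : Fact (1 ≤ q)] (hqp : q < p) (δ : ℝ)
    (φ : decaying) : modulatedPowerMorrey hn hqp δ φ ∈ VStar n p q := by
  have hp : 0 < p := by linarith [hq.out]
  obtain ⟨M, hM⟩ := φ.2.2.1
  have h : ∀ N, tail (modulatedPower n p δ φ) q N ≤ ‖(M : ℂ)‖ₑ ^ q * tail (f3 n p) q N := fun N =>
    (tail_mono hq.out (norm_modulatedPower_le n p δ hM) N).trans (tail_smul hq.out _ _ N).le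
  refine tendsto_of_tendsto_of_tendsto_of_le_of_le tendsto_const_nhds ?_ (fun _ => zero_le) h
  have hc : ‖(M : ℂ)‖ₑ ^ q ≠ ∞ := ENNReal.rpow_ne_top_of_nonneg (by linarith [hq.out]) enorm_ne_top
  simpa using ENNReal.Tendsto.const_mul (tendsto_tail_f3 hn hq.out hp) (Or.inr hc)

theorem ae_log_norm_ne_zero (hn : 1 ≤ n) :
    ∀ᵐ x : EuclideanSpace ℝ (Fin n), Real.log ‖x‖ ≠ 0 := by
  have : Nonempty (Fin n) := ⟨⟨0, hn⟩⟩
  have h1 : volume (sphere (0 : EuclideanSpace ℝ (Fin n)) 1) = 0 := Measure.addHaar_sphere _ _ _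
  have h0 : volume (sphere (0 : EuclideanSpace ℝ (Fin n)) 0) = 0 := Measure.addHaar_sphere _ _ _
  filter_upwards [measure_eq_zero_iff_ae_notMem.1 h0, measure_eq_zero_iff_ae_notMem.1 h1]
    with x hx0 hx1
  rw [mem_sphere_zero_iff_norm] at hx0 hx1
  exact Real.log_ne_zero.2 ⟨hx0, hx1, by linarith [norm_nonneg x]⟩

/-- Along the complex family of powers, `|x|^{-n/p₀}` is carried to `|x|^{-n/p}` by the exponential
of a multiple of `log |x|`. -/
theorem power_mul_cexp {p₀ p₁ θ : ℝ} (hp : 1 / p = (1 - θ) / p₀ + θ / p₁)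
    {x : EuclideanSpace ℝ (Fin n)} (hx : 0 < ‖x‖) :
    ((‖x‖ ^ (-(n : ℝ) / p₀) : ℝ) : ℂ) *
      Complex.exp (θ * (((n : ℝ) / p₀ - n / p₁) * Real.log ‖x‖ : ℝ)) =
      ((‖x‖ ^ (-(n : ℝ) / p) : ℝ) : ℂ) := by
  rw [← Complex.ofReal_mul, ← Complex.ofReal_exp, ← Complex.ofReal_mul, Real.rpow_def_of_pos hx,
    Real.rpow_def_of_pos hx, ← Real.exp_add]
  congr 2
  have h : -(n : ℝ) / p = -n * (1 / p) := by ring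
  rw [h, hp]
  ring

/-- The power `|x|^{-n/p}` lies in the second interpolation space of any two subspaces of Morrey
spaces that contain the modulated powers. -/
theorem f3_mem_secondSpace (hn : 1 ≤ n) {θ p₀ q₀ p₁ q₁ : ℝ} [hq₀ : Fact (1 ≤ q₀)]
    [hq₁ : Fact (1 ≤ q₁)] (hθ : 0 < θ) (hθ' : θ < 1) (h₀ : q₀ < p₀) (h₁ : q₁ < p₁)
    (hne : p₀ ≠ p₁) (hp : 1 / p = (1 - θ) / p₀ + θ / p₁)
    {V : Submodule ℂ (space n p₀ q₀)} {W : Submodule ℂ (space n p₁ q₁)}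
    (hV : ∀ δ ≠ 0, ∀ φ, modulatedPowerMorrey hn h₀ δ φ ∈ V)
    (hW : ∀ δ ≠ 0, ∀ φ, modulatedPowerMorrey hn h₁ δ φ ∈ W) :
    f3 n p ∈ secondSpace (incl V) (incl W) θ := by
  have hp₀ : 0 < p₀ := by linarith [hq₀.out]
  have hp₁ : 0 < p₁ := by linarith [hq₁.out]
  have hn0 : (n : ℝ) ≠ 0 := by exact_mod_cast (by omega : n ≠ 0)
  set δ : ℝ := n / p₀ - n / p₁ with hδdef
  have hδ : δ ≠ 0 := by
    rw [hδdef, sub_ne_zero]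
    intro h
    rw [div_eq_div_iff hp₀.ne' hp₁.ne'] at h
    exact hne (mul_left_cancel₀ hn0 h).symm
  have hnorm : ∀ {p q : ℝ} [hq : Fact (1 ≤ q)] (hqp : q < p) (δ : ℝ) (φ : decaying) (M : ℝ),
      (∀ v, ‖φ.1 v‖ ≤ M) →
      ‖modulatedPowerMorrey hn hqp δ φ‖ ≤ (eNorm (f3 n p) p q).toNNReal * M := by
    intro p q hq hqp δ φ M hM
    have hfin := (eNorm_f3_lt_top hn hq.out hqp).ne
    have hM0 : 0 ≤ M := (norm_nonneg _).trans (hM 0)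
    have h := ENNReal.toReal_mono (ENNReal.mul_ne_top ENNReal.ofReal_ne_top hfin)
      (eNorm_modulatedPower_le (n := n) (p := p) hq.out δ hM)
    rw [ENNReal.toReal_mul, ENNReal.toReal_ofReal hM0, mul_comm] at h
    exact h
  have hpow : ∀ {θ p : ℝ}, 1 / p = (1 - θ) / p₀ + θ / p₁ → ∀ {x : EuclideanSpace ℝ (Fin n)},
      0 < ‖x‖ → ((‖x‖ ^ (-(n : ℝ) / p₀) : ℝ) : ℂ) * Complex.exp (θ * (δ * Real.log ‖x‖ : ℝ)) =
      ((‖x‖ ^ (-(n : ℝ) / p) : ℝ) : ℂ) := fun hp _ hx => power_mul_cexp hp hx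
  have hpos : ∀ {x : EuclideanSpace ℝ (Fin n)}, Real.log ‖x‖ ≠ 0 → 0 < ‖x‖ := fun hx =>
    (norm_nonneg _).lt_of_ne' fun h => hx (by rw [h, Real.log_zero])
  refine mem_secondSpace_of_embedding
    (T₀ := (modulatedPowerMorrey hn h₀ δ).codRestrict V (hV δ hδ))
    (T₁ := (modulatedPowerMorrey hn h₁ (-δ)).codRestrict W (hW (-δ) (neg_ne_zero.2 hδ)))
    (hnorm h₀ δ) (hnorm h₁ (-δ)) (fun φ₀ φ₁ h => ?_) hθ hθ' fun φ₀ φ₁ h => ?_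
  · change modulatedPower n p₁ (-δ) φ₁ = modulatedPower n p₀ δ φ₀
    refine AEEqFun.ext ?_
    filter_upwards [coeFn_modulatedPower n p₁ (-δ) φ₁, coeFn_modulatedPower n p₀ δ φ₀,
      ae_log_norm_ne_zero hn] with x h1 h2 hx
    have h3 := hpow (θ := 1) (p := p₁) (by ring) (hpos hx)
    rw [Complex.ofReal_one, one_mul] at h3
    rw [h1, h2, ← h _ (mul_ne_zero hδ hx), neg_mul, ← h3]
    ring
  · change modulatedPower n p₀ δ φ₀ + modulatedPower n p₁ (-δ) φ₁ = f3 n p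
    refine AEEqFun.ext ?_
    filter_upwards [coeFn_modulatedPower n p₁ (-δ) φ₁, coeFn_modulatedPower n p₀ δ φ₀,
      ae_log_norm_ne_zero hn, coeFn_f3 n p,
      AEEqFun.coeFn_add (modulatedPower n p₀ δ φ₀) (modulatedPower n p₁ (-δ) φ₁)]
      with x h1 h2 hx h4 h5
    have h3 := hpow (θ := 1) (p := p₁) (by ring) (hpos hx)
    rw [Complex.ofReal_one, one_mul] at h3
    rw [h5, Pi.add_apply, h1, h2, h4, ← hpow hp (hpos hx), ← h _ (mul_ne_zero hδ hx), neg_mul, ← h3]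
    ring

/-! ### Ball averages as functionals on the sum space -/

/-- Hölder's inequality: the `L¹` norm on a ball is controlled by the Morrey norm. -/
theorem lintegral_ball_le (hq : 1 ≤ q) (f : L0 n) {r : ℝ} (hr : 0 < r) :
    ∫⁻ y in ball (0 : EuclideanSpace ℝ (Fin n)) r, ‖f y‖ₑ ≤
      volume (ball (0 : EuclideanSpace ℝ (Fin n)) r) ^ (1 - 1 / p) * eNorm f p q := by
  have hq0 : 0 < q := by linarith
  set v := volume (ball (0 : EuclideanSpace ℝ (Fin n)) r) with hv
  have hv0 : v ≠ 0 := (measure_ball_pos _ _ hr).ne'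
  have hvt : v ≠ ∞ := measure_ball_lt_top.ne
  have h1 := eLpNorm_le_eLpNorm_mul_rpow_measure_univ (p := 1) (q := ENNReal.ofReal q)
    (ENNReal.one_le_ofReal.2 hq)
    (f.aestronglyMeasurable.restrict (s := ball (0 : EuclideanSpace ℝ (Fin n)) r))
  rw [eLpNorm_one_eq_lintegral_enorm, eLpNorm_eq_lintegral_rpow_enorm_toReal
    (ENNReal.ofReal_pos.2 hq0).ne' ENNReal.ofReal_ne_top, ENNReal.toReal_ofReal hq0.le,
    Measure.restrict_apply_univ, ENNReal.toReal_one, ← hv, div_one] at h1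
  refine h1.trans ?_
  have h2 : v ^ (1 / p) * (v⁻¹ * ∫⁻ y in ball (0 : EuclideanSpace ℝ (Fin n)) r, ‖f y‖ₑ ^ q) ^ (1 / q)
      ≤ eNorm f p q :=
    le_trans (le_iSup (fun x : EuclideanSpace ℝ (Fin n) => volume (ball x r) ^ (1 / p) *
      ((volume (ball x r))⁻¹ * ∫⁻ y in ball x r, ‖f y‖ₑ ^ q) ^ (1 / q)) 0)
      (le_iSup₂_of_le r hr le_rfl)
  refine le_trans (le_of_eq ?_) (mul_le_mul_right h2 _)
  rw [ENNReal.mul_rpow_of_nonneg _ _ (by positivity), ← ENNReal.rpow_neg_one, ← ENNReal.rpow_mul,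
    ← mul_assoc, ← mul_assoc, ← ENNReal.rpow_add _ _ hv0 hvt, ← ENNReal.rpow_add _ _ hv0 hvt,
    mul_comm]
  congr 2
  ring

theorem integrableOn_ball (hq : 1 ≤ q) {f : L0 n} (hf : eNorm f p q < ∞) {r : ℝ} (hr : 0 < r) :
    IntegrableOn f (ball (0 : EuclideanSpace ℝ (Fin n)) r) volume := by
  refine ⟨f.aestronglyMeasurable.restrict, (lintegral_ball_le (p := p) hq f hr).trans_lt ?_⟩
  exact ENNReal.mul_lt_top (ENNReal.rpow_ne_top_of_ne_zero (measure_ball_pos _ _ hr).ne'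
    measure_ball_lt_top.ne).lt_top hf

/-- The average of `f` over `B(0, r)`. -/
noncomputable def ballAverage (r : ℝ) (f : L0 n) : ℂ :=
  ((volume.real (ball (0 : EuclideanSpace ℝ (Fin n)) r))⁻¹ : ℝ) *
    ∫ y in ball (0 : EuclideanSpace ℝ (Fin n)) r, f y

theorem ballAverage_add {r : ℝ} {f g : L0 n}
    (hf : IntegrableOn f (ball (0 : EuclideanSpace ℝ (Fin n)) r) volume)
    (hg : IntegrableOn g (ball (0 : EuclideanSpace ℝ (Fin n)) r) volume) :
    ballAverage r (f + g) = ballAverage r f + ballAverage r g := by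
  unfold ballAverage
  rw [← mul_add, ← integral_add hf hg]
  congr 1
  exact integral_congr_ae (ae_restrict_of_ae (AEEqFun.coeFn_add f g))

theorem ballAverage_smul (r : ℝ) (c : ℂ) (f : L0 n) :
    ballAverage r (c • f) = c * ballAverage r f := by
  have h : ∫ y in ball (0 : EuclideanSpace ℝ (Fin n)) r, (c • f) y =
      c * ∫ y in ball (0 : EuclideanSpace ℝ (Fin n)) r, f y := by
    rw [← integral_const_mul]
    exact integral_congr_ae (ae_restrict_of_ae (AEEqFun.coeFn_smul c f))
  unfold ballAverage
  rw [h, mul_left_comm]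

/-- With `Λ` the logarithm of the volume of the ball, the average over the ball is a functional of
norm at most `e^{-Λ/p}` on a Morrey space with exponent `p`. -/
theorem norm_ballAverage_le [hq : Fact (1 ≤ q)] {r : ℝ} (hr : 0 < r) (f : space n p q) :
    ‖ballAverage r (f : L0 n)‖ ≤
      Real.exp (-Real.log (volume.real (ball (0 : EuclideanSpace ℝ (Fin n)) r)) * (1 / p)) * ‖f‖ := by
  have hfin : eNorm (f : L0 n) p q < ∞ := f.2
  have hvt : volume (ball (0 : EuclideanSpace ℝ (Fin n)) r) ≠ ∞ := measure_ball_lt_top.ne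
  have hv0 : volume (ball (0 : EuclideanSpace ℝ (Fin n)) r) ≠ 0 := (measure_ball_pos _ _ hr).ne'
  set b := volume.real (ball (0 : EuclideanSpace ℝ (Fin n)) r) with hb
  have hb0 : 0 < b := ENNReal.toReal_pos hv0 hvt
  have h1 : ‖∫ y in ball (0 : EuclideanSpace ℝ (Fin n)) r, (f : L0 n) y‖ ≤ b ^ (1 - 1 / p) * ‖f‖ := by
    rw [← toReal_enorm]
    have h2 := (enorm_integral_le_lintegral_enorm (μ := volume.restrict
      (ball (0 : EuclideanSpace ℝ (Fin n)) r)) (f : L0 n)).trans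
        (lintegral_ball_le (p := p) hq.out (f : L0 n) hr)
    have h3 := ENNReal.toReal_mono (ENNReal.mul_ne_top
      (ENNReal.rpow_ne_top_of_ne_zero hv0 hvt) hfin.ne) h2
    rwa [ENNReal.toReal_mul, ← ENNReal.toReal_rpow] at h3
  unfold ballAverage
  rw [norm_mul, Complex.norm_real, Real.norm_of_nonneg (by positivity)]
  calc b⁻¹ * _ ≤ b⁻¹ * (b ^ (1 - 1 / p) * ‖f‖) := by gcongr
    _ = _ := by
      rw [← mul_assoc, ← Real.rpow_neg_one, ← Real.rpow_add hb0, Real.rpow_def_of_pos hb0]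
      congr 2
      ring

/-- The ball average as a continuous functional on a subspace of a Morrey space. -/
noncomputable def ballAverageCLM [hq : Fact (1 ≤ q)] (V : Submodule ℂ (space n p q)) {r : ℝ}
    (hr : 0 < r) : V →L[ℂ] ℂ :=
  LinearMap.mkContinuous
    { toFun := fun f => ballAverage r (incl V f)
      map_add' := fun f g => by
        rw [map_add]
        exact ballAverage_add (integrableOn_ball hq.out f.1.2 hr) (integrableOn_ball hq.out g.1.2 hr)
      map_smul' := fun c f => by
        rw [map_smul]
        exact ballAverage_smul r c _ } _ fun f => norm_ballAverage_le hr (f : space n p q)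

theorem exists_ballAverage_functional {p₀ q₀ p₁ q₁ : ℝ} [hq₀ : Fact (1 ≤ q₀)]
    [hq₁ : Fact (1 ≤ q₁)] (V : Submodule ℂ (space n p₀ q₀)) (W : Submodule ℂ (space n p₁ q₁))
    {r : ℝ} (hr : 0 < r) : ∃ ℓ : SumSpace (incl V) (incl W) →L[ℂ] ℂ,
      ∀ x, ℓ x = ballAverage r (SumSpace.toAmbient (incl V) (incl W) x) := by
  set L : WithLp 1 (V × W) →L[ℂ] ℂ := ((ballAverageCLM V hr).coprod (ballAverageCLM W hr)) ∘L
    (WithLp.prodContinuousLinearEquiv 1 ℂ V W).toContinuousLinearMap with hL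
  have h : ∀ x : WithLp 1 (V × W), L x = ballAverage r (incl V x.fst + incl W x.snd) := fun x =>
    (ballAverage_add (integrableOn_ball hq₀.out x.fst.1.2 hr)
      (integrableOn_ball hq₁.out x.snd.1.2 hr)).symm
  refine ⟨(sumKer (incl V) (incl W)).liftQL L fun x hx => ?_, fun x => ?_⟩
  · have hx' : incl V x.fst + incl W x.snd = 0 := hx
    change L x = 0
    rw [h, hx', ← zero_smul ℂ (0 : L0 n), ballAverage_smul, zero_mul]
  · obtain ⟨x, rfl⟩ := (sumKer (incl V) (incl W)).mkQ_surjective x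
    exact h x

/-! ### The power is not in the first interpolation space -/

theorem le_norm_ballAverage_f3 (hp : 1 < p) (hn : 1 ≤ n) {r : ℝ} (hr : 0 < r) :
    r ^ (-(n : ℝ) / p) ≤ ‖ballAverage r (f3 n p)‖ := by
  have hvt : volume (ball (0 : EuclideanSpace ℝ (Fin n)) r) ≠ ∞ := measure_ball_lt_top.ne
  have hv0 : volume (ball (0 : EuclideanSpace ℝ (Fin n)) r) ≠ 0 := (measure_ball_pos _ _ hr).ne'
  have hb0 : 0 < volume.real (ball (0 : EuclideanSpace ℝ (Fin n)) r) := ENNReal.toReal_pos hv0 hvt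
  have hint := (integrableOn_ball le_rfl (eNorm_f3_lt_top hn le_rfl hp) hr).congr
    (ae_restrict_of_ae (coeFn_f3 n p))
  have hint' : IntegrableOn (fun x : EuclideanSpace ℝ (Fin n) => ‖x‖ ^ (-(n : ℝ) / p))
      (ball 0 r) volume := by
    have h := hint.re
    simp only [RCLike.re_to_complex, Complex.ofReal_re] at h
    exact h
  have h1 : ∫ y in ball (0 : EuclideanSpace ℝ (Fin n)) r, f3 n p y =
      ((∫ y in ball (0 : EuclideanSpace ℝ (Fin n)) r, ‖y‖ ^ (-(n : ℝ) / p) : ℝ) : ℂ) := by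
    rw [← integral_complex_ofReal]
    exact integral_congr_ae (ae_restrict_of_ae (coeFn_f3 n p))
  have h2 : volume.real (ball (0 : EuclideanSpace ℝ (Fin n)) r) * r ^ (-(n : ℝ) / p) ≤
      ∫ y in ball (0 : EuclideanSpace ℝ (Fin n)) r, ‖y‖ ^ (-(n : ℝ) / p) := by
    rw [← smul_eq_mul, ← setIntegral_const]
    refine integral_mono_ae (integrableOn_const hvt) hint' ?_
    have hz : ∀ᵐ y : EuclideanSpace ℝ (Fin n), Real.log ‖y‖ ≠ 0 := ae_log_norm_ne_zero hn
    filter_upwards [ae_restrict_mem measurableSet_ball, ae_restrict_of_ae hz] with y hy hy0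
    rw [mem_ball_zero_iff] at hy
    have hpos : 0 < ‖y‖ := (norm_nonneg _).lt_of_ne' fun h => hy0 (by rw [h, Real.log_zero])
    refine Real.rpow_le_rpow_of_nonpos hpos hy.le ?_
    exact div_nonpos_of_nonpos_of_nonneg (neg_nonpos.2 (Nat.cast_nonneg n)) (by linarith)
  unfold ballAverage
  rw [h1, ← Complex.ofReal_mul, Complex.norm_real, ← div_eq_inv_mul]
  refine le_trans ?_ (Real.le_norm_self _)
  rw [le_div_iff₀ hb0, mul_comm]
  exact h2

/-- The power `|x|^{-n/p}` is in none of the first interpolation spaces: its averages over `B(0, r)`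
have exactly the rate `|B(0, r)|^{-1/p}`, which elements of those spaces must beat as `r → ∞`. -/
theorem f3_notMem_firstSpace (hn : 1 ≤ n) {θ p₀ q₀ p₁ q₁ : ℝ} [hq₀ : Fact (1 ≤ q₀)]
    [hq₁ : Fact (1 ≤ q₁)] (hθ : 0 < θ) (hθ' : θ < 1) (h₀ : q₀ < p₀) (h₁ : q₁ < p₁)
    (hne : p₀ ≠ p₁) (hp : 1 / p = (1 - θ) / p₀ + θ / p₁)
    (V : Submodule ℂ (space n p₀ q₀)) (W : Submodule ℂ (space n p₁ q₁)) :
    f3 n p ∉ firstSpace (incl V) (incl W) θ := by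
  rintro ⟨F, hF, hFθ⟩
  have hp₀ : 1 < p₀ := by linarith [hq₀.out]
  have hp₁ : 1 < p₁ := by linarith [hq₁.out]
  have hinv₀ : 0 < 1 / p₀ := by positivity
  have hinv₁ : 0 < 1 / p₁ := by positivity
  have hinv₀' : 1 / p₀ < 1 := by rw [div_lt_one (by linarith)]; exact hp₀
  have hinv₁' : 1 / p₁ < 1 := by rw [div_lt_one (by linarith)]; exact hp₁
  have hp' : 1 / p = (1 - θ) * (1 / p₀) + θ * (1 / p₁) := by rw [hp]; ring
  have hpinv : 0 < 1 / p := by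
    rw [hp']
    exact add_pos (mul_pos (by linarith) hinv₀) (mul_pos hθ hinv₁)
  have hp0 : 0 < p := one_div_pos.1 hpinv
  have hp1 : 1 < p := by
    rw [← div_lt_one hp0, hp']
    nlinarith
  have ha : 1 / p₀ ≠ 1 / p₁ := fun h => hne (by simpa using h)
  set β := volume.real (ball (0 : EuclideanSpace ℝ (Fin n)) 1) with hβ
  have hβ0 : 0 < β := ENNReal.toReal_pos (measure_ball_pos _ _ one_pos).ne' measure_ball_lt_top.ne
  have hvol : ∀ {r : ℝ}, 0 < r →
      volume.real (ball (0 : EuclideanSpace ℝ (Fin n)) r) = r ^ (n : ℝ) * β := by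
    intro r hr
    rw [Measure.real, volume_ball_eq hn 0 hr, ENNReal.toReal_mul, ← ENNReal.toReal_rpow,
      ENNReal.toReal_ofReal hr.le]
    rfl
  have hc : 0 < β ^ (1 / p) := by positivity
  have hΛ : Tendsto (fun r : ℝ => Real.log (r ^ (n : ℝ) * β)) atTop atTop :=
    Real.tendsto_log_atTop.comp
      ((tendsto_rpow_atTop (by exact_mod_cast hn)).atTop_mul_const hβ0)
  obtain ⟨r, hr, hℓ⟩ := ((eventually_gt_atTop (0 : ℝ)).and
    (hΛ.eventually (hF.eventually_norm_le hθ hθ' ha (half_pos hc)))).exists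
  obtain ⟨ℓ, hℓavg⟩ := exists_ballAverage_functional V W hr
  have h := hℓ ℓ (fun x => ?_) fun x => ?_
  · rw [hℓavg, hFθ, ← hp', ← Real.rpow_def_of_pos (by positivity),
      Real.mul_rpow (by positivity) hβ0.le, ← Real.rpow_mul hr.le] at h
    have h2 : β ^ (1 / p) ≤ r ^ ((n : ℝ) * (1 / p)) * β ^ (1 / p) * ‖ballAverage r (f3 n p)‖ := by
      calc β ^ (1 / p) = r ^ ((n : ℝ) * (1 / p)) * β ^ (1 / p) * r ^ (-(n : ℝ) / p) := by
            rw [mul_right_comm, ← Real.rpow_add hr,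
              show (n : ℝ) * (1 / p) + -(n : ℝ) / p = 0 by ring, Real.rpow_zero, one_mul]
        _ ≤ _ := by
            gcongr
            exact le_norm_ballAverage_f3 hp1 hn hr
    linarith
  · have h3 : SumSpace.toAmbient (incl V) (incl W) (SumSpace.left (incl V) (incl W) x) =
        incl V x := (SumSpace.toAmbient_ofProd (x, 0)).trans (by rw [map_zero, add_zero])
    rw [hℓavg, h3, ← hvol hr]
    exact norm_ballAverage_le hr (x : space n p₀ q₀)
  · have h3 : SumSpace.toAmbient (incl V) (incl W) (SumSpace.right (incl V) (incl W) x) =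
        incl W x := (SumSpace.toAmbient_ofProd (0, x)).trans (by rw [map_zero, zero_add])
    rw [hℓavg, h3, ← hvol hr]
    exact norm_ballAverage_le hr (x : space n p₁ q₁)

end Morrey

open Morrey ComplexInterpolation
theorem corollary6p5 (n : ℕ) (hn : 1 ≤ n) (θ p₀ q₀ p₁ q₁ p : ℝ)
    [Fact (1 ≤ q₀)] [Fact (1 ≤ q₁)]
    (hθ : 0 < θ) (hθ' : θ < 1)
    (h₀ : q₀ < p₀) (h₁ : q₁ < p₁)
    (hprop : p₀ / q₀ = p₁ / q₁) (hne : q₀ ≠ q₁)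
    (hp : 1 / p = (1 - θ) / p₀ + θ / p₁) :
    f3 n p ∈ secondSpace (incl (V0 n p₀ q₀)) (incl (V0 n p₁ q₁)) θ ∧
    f3 n p ∉ firstSpace (incl (V0 n p₀ q₀)) (incl (V0 n p₁ q₁)) θ ∧
    f3 n p ∈ secondSpace (incl (VStar n p₀ q₀)) (incl (VStar n p₁ q₁)) θ ∧
    f3 n p ∈ secondSpace (incl (VInfty n p₀ q₀)) (incl (VInfty n p₁ q₁)) θ ∧
    f3 n p ∉ firstSpace (incl (VStar n p₀ q₀)) (incl (VStar n p₁ q₁)) θ ∧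
    f3 n p ∉ firstSpace (incl (VInfty n p₀ q₀)) (incl (VInfty n p₁ q₁)) θ := by
  have hp₀ : 0 < p₀ := by linarith [(Fact.out : 1 ≤ q₀)]
  have hpne : p₀ ≠ p₁ := by
    rintro rfl
    exact hne (inv_injective (mul_left_cancel₀ hp₀.ne' hprop))
  have hout := f3_notMem_firstSpace hn hθ hθ' h₀ h₁ hpne hp
  exact ⟨f3_mem_secondSpace hn hθ hθ' h₀ h₁ hpne hp
      (fun _ => modulatedPower_mem_V0 hn h₀) (fun _ => modulatedPower_mem_V0 hn h₁), hout _ _,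
    f3_mem_secondSpace hn hθ hθ' h₀ h₁ hpne hp
      (fun δ _ => modulatedPower_mem_VStar hn h₀ δ) (fun δ _ => modulatedPower_mem_VStar hn h₁ δ),
    f3_mem_secondSpace hn hθ hθ' h₀ h₁ hpne hp
      (fun _ => modulatedPower_mem_VInfty hn h₀) (fun _ => modulatedPower_mem_VInfty hn h₁),
    hout _ _, hout _ _⟩
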